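/- \textbf{Conventions.} Definable means definable with parameters. For a structure $\mathcal M$ with universe $M$ expanding a dense linear order without endpoints, $M$ carries the order topology and $M^n$ the product topology; the open core $\mathcal M^\circ$ is the structure on $M$ with one relation for each open set $U\subseteq M^n$ ($n\in\mathbb N$) definable in $\mathcal M$. Two structures with the same universe are interdefinable if they define the same sets. A theory $T'$ is an open core of a theory $\tilde T$ extending the theory of dense linear orders without endpoints if for every $\mathcal M\models \tilde T$ there is $\mathcal M'\models T'$ with the same universe such that $\mathcal M^\circ$ and $\mathcal M'$ are interdefinable. A theory has the exchange property (EP) if in each of its models $a\in\operatorname{dcl}(S\cup\{b\})\setminus \operatorname{dcl}(S)$ implies $b\in\operatorname{dcl}(S\cup\{a\})$, for all sets $S$ and elements $a,b$. Let $T$ be the theory of ordered divisible abelian groups with a distinguished positive element, in the language $\mathcal L=(<,+,0,1)$. Let $\mathcal L_t$ be the extension of $\mathcal L$ by a unary function symbol $\lambda_q$ for each $q\in\mathbb Q(t)$, and let $T_t$ be the $\mathcal L_t$-theory extending $T$ by axioms expressing that (T1) $(M,+,0,(\lambda_q)_{q\in\mathbb Q(t)})$ is a $\mathbb Q(t)$-vector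 space; (T2) whenever $q_1,\dots,q_m\in\mathbb Q(t)$ are $\mathbb Q$-linearly independent, the image of $x\mapsto(\lambda_{q_1}(x),\dots,\lambda_{q_m}(x))$ is dense in $M^m$. \textbf{Theorem.} The theory $T$ is an open core of $T_t$. Moreover, for every $\mathcal M\models T_t$: (a) every open set $U\subseteq M^n$ definable in $\mathcal M$ is already definable in the reduct $(M,<,+,0,1)$; (b) $\mathcal M$ defines a function $f:M\to M$ whose graph is dense in $M^2$. Furthermore $T$ is complete and o-minimal (it extends the theory of dense linear orders without endpoints, and in each of its models every definable subset of the universe is a finite union of points and open intervals with endpoints in $M\cup\{\pm\infty\}$), and $T_t$ is consistent and has EP. Consequently the following question of Dolich, Miller and Steinhorn has a negative answer: if $T$ is a complete o-minimal extension of the theory of densely ordered groups, $\tilde T$ is any theory having $T$ as an open core, and some model of $\tilde T$ defines a somewhere dense graph, must EP fail for $\tilde T$? -/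

import Mathlib

namespace OpenCore

open FirstOrder FirstOrder.Language

universe u v u' v' w

section General

/-- The strict order `a < b` on a structure in an ordered language, read off the order symbol. -/
def SLt (L : FirstOrder.Language.{u, v}) [L.IsOrdered] {M : Type w} [L.Structure M] (a b : M) : Prop :=
  Structure.RelMap (leSymb : L.Relations 2) ![a, b] ∧
    ¬ Structure.RelMap (leSymb : L.Relations 2) ![b, a]

/-- The order topology on a structure in an ordered language (generated by the open rays). -/
@[reducible]
def orderTop (L : FirstOrder.Language.{u, v}) [L.IsOrdered] (M : Type w) [L.Structure M] :
    TopologicalSpace M :=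
  TopologicalSpace.generateFrom
    {s | ∃ a : M, s = {b | SLt L a b} ∨ s = {b | SLt L b a}}

/-- `U ⊆ Mⁿ` is open, for the product of the order topologies. -/
def IsOpenIn (L : FirstOrder.Language.{u, v}) [L.IsOrdered] {M : Type w} [L.Structure M] {n : ℕ}
    (U : Set (Fin n → M)) : Prop :=
  letI := orderTop L M
  IsOpen U

/-- `U ⊆ Mⁿ` is dense in `Mⁿ`, for the product of the order topologies. -/
def IsDenseIn (L : FirstOrder.Language.{u, v}) [L.IsOrdered] {M : Type w} [L.Structure M] {n : ℕ}
    (U : Set (Fin n → M)) : Prop :=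
  letI := orderTop L M
  Dense U

/-- `S ⊆ Mⁿ` is definable in the `L`-structure `M`, with parameters from `M`. -/
def DefinableIn (L : FirstOrder.Language.{u, v}) {M : Type w} [L.Structure M] {n : ℕ} (S : Set (Fin n → M)) : Prop :=
  (Set.univ : Set M).Definable L S

/-- The language of the open core of `M`: an `n`-ary relation symbol for every open subset of
`Mⁿ` that is definable in `M`. -/
def coreLang (L : FirstOrder.Language.{u, v}) [L.IsOrdered] (M : Type w) [L.Structure M] : FirstOrder.Language.{0, w} where
  Functions := fun _ => Empty
  Relations := fun n => {U : Set (Fin n → M) // IsOpenIn L U ∧ DefinableIn L U}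

/-- The open core `M°` of `M`, as a structure on the universe of `M`. -/
instance coreStructure (L : FirstOrder.Language.{u, v}) [L.IsOrdered] (M : Type w) [L.Structure M] :
    (coreLang L M).Structure M where
  funMap := fun f => f.elim
  RelMap := fun U x => x ∈ U.1

/-- Two structures with the same universe are interdefinable: they define (with parameters) the
same sets. -/
def Interdefinable (L : FirstOrder.Language.{u, v}) (L' : FirstOrder.Language.{u', v'}) (M : Type w)
    [L.Structure M] [L'.Structure M] : Prop :=
  ∀ (n : ℕ) (S : Set (Fin n → M)), DefinableIn L S ↔ DefinableIn L' S

/-- `T` extends the theory of dense linear orders without endpoints. -/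
def ExtendsDLO {L : FirstOrder.Language.{u, v}} [L.IsOrdered] (T : L.Theory) : Prop :=
  ∀ φ ∈ L.dlo, T ⊨ᵇ φ

/-- `T'` is an open core of the theory `T` (where `T` extends the theory of dense linear orders):
the open core of every model `M` of `T` is interdefinable with a model of `T'`
on the same universe. -/
def IsOpenCore {L' : FirstOrder.Language.{u', v'}} (T' : L'.Theory)
    {L : FirstOrder.Language.{u, v}} [L.IsOrdered] (T : L.Theory) : Prop :=
  ExtendsDLO T ∧
    ∀ (M : Type w) [L.Structure M] [Nonempty M], M ⊨ T →
      ∃ _ : L'.Structure M, M ⊨ T' ∧ Interdefinable (coreLang L M) L' M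

/-- Open intervals with endpoints in `M ∪ {±∞}`. -/
def IsOpenInterval (L : FirstOrder.Language.{u, v}) [L.IsOrdered] {M : Type w} [L.Structure M]
    (J : Set M) : Prop :=
  (∃ a b, J = {x | SLt L a x ∧ SLt L x b}) ∨ (∃ a, J = {x | SLt L a x}) ∨
    (∃ b, J = {x | SLt L x b}) ∨ J = Set.univ

/-- `M` is o-minimal: every definable subset of `M` is a finite union of points and open
intervals. -/
def IsOMinimal (L : FirstOrder.Language.{u, v}) [L.IsOrdered] (M : Type w) [L.Structure M] : Prop :=
  ∀ S : Set M, (Set.univ : Set M).Definable₁ L S →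
    ∃ F : Set (Set M), F.Finite ∧ (∀ J ∈ F, (∃ a, J = {a}) ∨ IsOpenInterval L J) ∧ S = ⋃₀ F

/-- A theory is o-minimal if it extends the theory of dense linear orders without endpoints and
all its models are o-minimal. -/
def IsOMinimalTheory {L : FirstOrder.Language.{u, v}} [L.IsOrdered] (T : L.Theory) : Prop :=
  ExtendsDLO T ∧ ∀ (M : Type w) [L.Structure M] [Nonempty M], M ⊨ T → IsOMinimal L M

/-- The definable closure of `A` in `M`: the elements `b` such that `{b}` is definable
over `A`. -/
def dcl (L : FirstOrder.Language.{u, v}) {M : Type w} [L.Structure M] (A : Set M) : Set M :=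
  {b | A.Definable₁ L {b}}

/-- The exchange property for a structure. -/
def HasEP (L : FirstOrder.Language.{u, v}) (M : Type w) [L.Structure M] : Prop :=
  ∀ (S : Set M) (a b : M), a ∈ dcl L (S ∪ {b}) \ dcl L S → b ∈ dcl L (S ∪ {a})

/-- The exchange property for a theory. -/
def TheoryHasEP {L : FirstOrder.Language.{u, v}} (T : L.Theory) : Prop :=
  ∀ (M : Type w) [L.Structure M] [Nonempty M], M ⊨ T → HasEP L M

end General

section Languages

/-- The language `(<, +, 0, 1)`; following Mathlib, the order symbol is `≤`, and `x < y`
abbreviates `x ≤ y ∧ ¬ y ≤ x`. -/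
abbrev LOag : FirstOrder.Language :=
  FirstOrder.Language.sum FirstOrder.Language.presburger FirstOrder.Language.order

/-- A unary function symbol for every element of `ℚ(t)`. -/
inductive ScalarFunc : ℕ → Type
  | lam (q : RatFunc ℚ) : ScalarFunc 1

/-- The language with the unary function symbols `λ_q`, `q ∈ ℚ(t)`, only. -/
abbrev LScalar : FirstOrder.Language := ⟨ScalarFunc, fun _ => Empty⟩

/-- The language `(<, +, 0, 1, (λ_q)_{q ∈ ℚ(t)})`. -/
abbrev LQt : FirstOrder.Language := LOag.sum LScalar

/-- The inclusion of `(<, +, 0, 1)` in `(<, +, 0, 1, (λ_q)_q)`. -/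
abbrev incl : LOag →ᴸ LQt := LHom.sumInl

instance : LQt.IsOrdered := ⟨incl.onRelation leSymb⟩

/-- The `(<, +, 0, 1)`-reduct of a `(<, +, 0, 1, (λ_q)_q)`-structure. -/
@[reducible]
def reduct (M : Type w) [LQt.Structure M] : LOag.Structure M := incl.reduct M

variable {α : Type u}

def zeroT : LOag.Term α := Constants.term (Sum.inl presburgerFunc.zero)

def oneT : LOag.Term α := Constants.term (Sum.inl presburgerFunc.one)

def addT (s t : LOag.Term α) : LOag.Term α := Functions.apply₂ (Sum.inl presburgerFunc.add) s t

/-- The term `t + ⋯ + t` (`n` summands). -/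
def nsmulT : ℕ → LOag.Term α → LOag.Term α
  | 0, _ => zeroT
  | n + 1, t => addT (nsmulT n t) t

/-- The sum of two terms of the larger language. -/
def addTt (s t : LQt.Term α) : LQt.Term α :=
  Functions.apply₂ (incl.onFunction (Sum.inl presburgerFunc.add)) s t

/-- The term `λ_q t`. -/
def lamT (q : RatFunc ℚ) (t : LQt.Term α) : LQt.Term α :=
  Functions.apply₁ (Sum.inr (ScalarFunc.lam q)) t

end Languages

section Theories

/-- The axioms of ordered abelian groups with a distinguished positive element `1`. -/
def oagAxioms : LOag.Theory :=
  LOag.linearOrderTheory ∪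
  { -- addition is associative and commutative, with neutral element `0` and negatives
    ∀' ∀' ∀' ((addT (addT (&0) (&1)) (&2)) =' (addT (&0) (addT (&1) (&2)))),
    ∀' ∀' ((addT (&0) (&1)) =' (addT (&1) (&0))),
    ∀' ((addT (&0) zeroT) =' (&0)),
    ∀' ∃' ((addT (&0) (&1)) =' zeroT),
    -- the order is translation invariant, and `0 < 1`
    ∀' ∀' ∀' (Term.lt (&0) (&1) ⟹ Term.lt (addT (&0) (&2)) (addT (&1) (&2))),
    (Term.lt zeroT oneT : LOag.BoundedFormula Empty 0) }

/-- Divisibility by `n`: for every `x` there is `y` with `n y = x`. -/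
def divisibleBy (n : ℕ) : LOag.Sentence :=
  ∀' ∃' ((nsmulT n (&1)) =' (&0))

/-- The theory of ordered divisible abelian groups with a distinguished positive element. -/
def ODAG : LOag.Theory :=
  oagAxioms ∪ {φ | ∃ n : ℕ, 1 ≤ n ∧ φ = divisibleBy n}

/-- The scalar multiplications `λ_q` make the additive group a `ℚ(t)`-vector space. -/
def vectorSpaceAxioms : LQt.Theory :=
  {φ | ∃ q : RatFunc ℚ,
      φ = ∀' ∀' ((lamT q (addTt (&0) (&1))) =' (addTt (lamT q (&0)) (lamT q (&1))))} ∪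
  {φ | ∃ q r : RatFunc ℚ, φ = ∀' ((lamT (q + r) (&0)) =' (addTt (lamT q (&0)) (lamT r (&0))))} ∪
  {φ | ∃ q r : RatFunc ℚ, φ = ∀' ((lamT (q * r) (&0)) =' (lamT q (lamT r (&0))))} ∪
  {∀' ((lamT 1 (&0)) =' (&0))}

/-- The image of `x ↦ (λ_{q₁} x, …, λ_{qₘ} x)` is dense: for all `a₁, …, aₘ, b₁, …, bₘ`, if
`aᵢ < bᵢ` for all `i` then there is `x` with `aᵢ < λ_{qᵢ} x < bᵢ` for all `i`. -/
noncomputable def denseImage {m : ℕ} (q : Fin m → RatFunc ℚ) : LQt.Sentence :=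
  BoundedFormula.alls (n := m + m)
    ((BoundedFormula.iInf fun i : Fin m =>
        Term.lt (&(Fin.castAdd m i)) (&(Fin.natAdd m i))) ⟹
      ∃' (BoundedFormula.iInf fun i : Fin m =>
        Term.lt (&(Fin.castAdd m i).castSucc) (lamT (q i) (&(Fin.last (m + m)))) ⊓
        Term.lt (lamT (q i) (&(Fin.last (m + m)))) (&(Fin.natAdd m i).castSucc)))

/-- The theory `T_t`: ordered divisible abelian groups with a distinguished positive element and
a `ℚ(t)`-vector space structure such that `(λ_{q₁}, …, λ_{qₘ})` has dense image
whenever `q₁, …, qₘ` are linearly independent over `ℚ`. -/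
def Tt : LQt.Theory :=
  incl.onTheory ODAG ∪ vectorSpaceAxioms ∪
    {φ | ∃ (m : ℕ) (q : Fin m → RatFunc ℚ), LinearIndependent ℚ q ∧ φ = denseImage q}

end Theories

end OpenCore

/-! Everything rests on a quantifier elimination that treats both theories at once. Let `K` be a
field of characteristic 0 acting on an ordered group `M` so that ℚ-independent tuples of scalars
have dense image (`DenseScalars`); `K = ℚ` covers `ODAG` and `K = ℚ(t)` covers `Tt`. To eliminate
`x` from equations and strict inequalities affine over `K`, solve for `x` if some equation involves
it. Otherwise write the scalars in the inequalities over a ℚ-independent tuple `p`. The conditions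
become rational affine inequalities in the elements `p k • x`; they cut out an open set, so by
density the values `p k • x` may be replaced by independent unknowns `z k` (`exists_scalars_iff`).
These are removed by Fourier–Motzkin elimination over ℚ.

For `K = ℚ` this yields completeness, since a sentence reduces to signs of rational multiples of the
distinguished positive element, and o-minimality, since a system in one unknown is an intersection
of points and intervals. For `K = ℚ(t)` it identifies `dcl A` with the span of `A` and the
distinguished element, so exchange is that of linear algebra.

For open sets, the main step is `definable_closure_clause`: the closure of the solution set of a
system over `K` is definable in the ordered group. The equations are solved by parameters `y`, the
products `p k • y j` range over a dense set, and the closure is therefore that of a rational affine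
image of an open set given by rational inequalities. An open definable set is the complement of a
finite union of such closures. Conversely, the positivity sets of rational affine functions are open
and generate all sets definable in the reduct.

The dense graph is that of `x ↦ t • x`, because 1 and `t` are ℚ-independent. Consistency comes from
ordering a `ℚ(t)`-vector space by an injective ℚ-linear map to ℝ, chosen so that a separate
generator answers each of countably many density requirements (`exists_denseScalars`). -/

namespace OpenCore

open FirstOrder FirstOrder.Language

universe u v u' v' w

/-! ### Rational scalars in an ordered group -/

section OrderedRatModule

variable {M : Type*} [AddCommGroup M] [LinearOrder M] [IsOrderedAddMonoid M] [Module ℚ M]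

/-- Compatibility of the order with rational scalars is automatic: clearing the denominator turns `r
• x` into a natural multiple of `x`. -/
theorem rat_smul_pos {r : ℚ} {x : M} (hr : 0 < r) (hx : 0 < x) : 0 < r • x := by
  by_contra h
  have h1 : (r.den : ℚ) • (r • x) = r.num.toNat • x := by
    rw [smul_smul, mul_comm, Rat.mul_den_eq_num]
    have : (r.num : ℚ) = (r.num.toNat : ℚ) := by
      have : ((r.num.toNat : ℤ) : ℚ) = r.num := by
        rw [Int.toNat_of_nonneg (Rat.num_pos.2 hr).le]
      rw [← this, Int.cast_natCast]
    rw [this, Nat.cast_smul_eq_nsmul]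
  rw [Nat.cast_smul_eq_nsmul] at h1
  have h2 : r.den • (r • x) ≤ 0 := nsmul_nonpos (not_lt.1 h) _
  have h3 : 0 < r.num.toNat • x := nsmul_pos hx (by have := Rat.num_pos.2 hr; omega)
  rw [h1] at h2
  exact absurd h3 (not_lt.2 h2)

theorem rat_smul_lt_smul {r : ℚ} {x y : M} (hr : 0 < r) (h : x < y) : r • x < r • y := by
  have := rat_smul_pos hr (sub_pos.2 h)
  rwa [smul_sub, sub_pos] at this

theorem rat_smul_lt_smul_iff {r : ℚ} {x y : M} (hr : 0 < r) : r • x < r • y ↔ x < y := by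
  refine ⟨fun h => ?_, rat_smul_lt_smul hr⟩
  have := rat_smul_lt_smul (inv_pos.2 hr) h
  rwa [inv_smul_smul₀ hr.ne', inv_smul_smul₀ hr.ne'] at this

variable (M) in
theorem denselyOrdered_of_ratModule : DenselyOrdered M := by
  refine ⟨fun a b h => ⟨(1 / 2 : ℚ) • (a + b), ?_, ?_⟩⟩
  · rw [← rat_smul_lt_smul_iff (r := 2) (by norm_num), smul_smul]
    norm_num
    rw [two_smul ℚ a]
    exact add_lt_add_right h a
  · rw [← rat_smul_lt_smul_iff (r := 2) (by norm_num), smul_smul]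
    norm_num
    rw [two_smul ℚ b]
    exact add_lt_add_left h b

end OrderedRatModule

/-! ### Fourier–Motzkin elimination for strict inequalities -/

section FourierMotzkin

variable {M : Type*} [AddCommGroup M] [LinearOrder M] [IsOrderedAddMonoid M] [Module ℚ M]
  [Nontrivial M]

/-- One step of Fourier–Motzkin elimination for a system of strict inequalities
`0 < w + r • x`, with unknown `x`. -/
noncomputable def posElim {W : Type*} [AddCommGroup W] [Module ℚ W] (l : List (W × ℚ)) : List W :=
  ((l.filter fun p => p.2 = 0).map Prod.fst) ++
    (l.filter fun p => 0 < p.2).flatMap fun p =>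
      (l.filter fun n => n.2 < 0).map fun n => p.2 • n.1 - n.2 • p.1

/-- A positive coefficient gives a lower bound for `x`, a negative one an upper bound. As the order
is dense, a common solution exists once every lower bound lies below every upper bound; each such
comparison is the positive combination of two inequalities that cancels `x`. -/
theorem exists_iff_posElim {W : Type*} [AddCommGroup W] [Module ℚ W] (l : List (W × ℚ))
    (e : W →ₗ[ℚ] M) :
    (∃ x : M, ∀ p ∈ l, 0 < e p.1 + p.2 • x) ↔ ∀ w ∈ posElim l, 0 < e w := by
  have hd := denselyOrdered_of_ratModule M
  have key : ∀ (p : W × ℚ) (x : M), 0 < p.2 →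
      (0 < e p.1 + p.2 • x ↔ -(p.2⁻¹ • e p.1) < x) := by
    intro p x hp
    rw [← rat_smul_lt_smul_iff (x := -(p.2⁻¹ • e p.1)) hp, smul_neg, smul_inv_smul₀ hp.ne',
      neg_lt_iff_pos_add']
  have key' : ∀ (p : W × ℚ) (x : M), p.2 < 0 →
      (0 < e p.1 + p.2 • x ↔ x < -(p.2⁻¹ • e p.1)) := by
    intro p x hp
    rw [← rat_smul_lt_smul_iff (x := x) (neg_pos.2 hp), neg_smul, neg_smul, smul_neg,
      smul_inv_smul₀ hp.ne, neg_neg, neg_lt_iff_pos_add]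
  have comb : ∀ p n : W × ℚ, 0 < p.2 → n.2 < 0 →
      (0 < e (p.2 • n.1 - n.2 • p.1) ↔ -(p.2⁻¹ • e p.1) < -(n.2⁻¹ • e n.1)) := by
    intro p n hp hn
    have h1 : (p.2 * -n.2) • -(p.2⁻¹ • e p.1) = n.2 • e p.1 := by
      rw [mul_comm, mul_smul, smul_neg, smul_inv_smul₀ hp.ne', smul_neg, neg_smul, neg_neg]
    have h2 : (p.2 * -n.2) • -(n.2⁻¹ • e n.1) = p.2 • e n.1 := by
      rw [mul_smul, neg_smul, smul_neg, smul_neg, smul_neg, neg_neg, smul_inv_smul₀ hn.ne]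
    rw [← rat_smul_lt_smul_iff (x := -(p.2⁻¹ • e p.1)) (mul_pos hp (neg_pos.2 hn)), h1, h2,
      map_sub, map_smul, map_smul, sub_pos]
  simp only [posElim, List.mem_append, List.mem_map, List.mem_filter, List.mem_flatMap,
    decide_eq_true_eq]
  constructor
  · rintro ⟨x, hx⟩ w (⟨p, ⟨hp, h0⟩, rfl⟩ | ⟨p, ⟨hp, h0⟩, n, ⟨hn, h1⟩, rfl⟩)
    · simpa [h0] using hx p hp
    · exact (comb p n h0 h1).2 (((key p x h0).1 (hx p hp)).trans ((key' n x h1).1 (hx n hn)))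
  · intro h
    obtain ⟨x, hx, hx'⟩ := Order.exists_between_finsets
      (((l.filter fun p => 0 < p.2).map fun p => -(p.2⁻¹ • e p.1)).toFinset)
      (((l.filter fun p => p.2 < 0).map fun p => -(p.2⁻¹ • e p.1)).toFinset) (by
        simp only [List.mem_toFinset, List.mem_map, List.mem_filter, decide_eq_true_eq]
        rintro _ ⟨p, ⟨hp, h0⟩, rfl⟩ _ ⟨n, ⟨hn, h1⟩, rfl⟩
        exact (comb p n h0 h1).1 (h _ (Or.inr ⟨p, ⟨hp, h0⟩, n, ⟨hn, h1⟩, rfl⟩)))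
    simp only [List.mem_toFinset, List.mem_map, List.mem_filter, decide_eq_true_eq] at hx hx'
    refine ⟨x, fun p hp => ?_⟩
    rcases lt_trichotomy p.2 0 with h0 | h0 | h0
    · exact (key' p x h0).2 (hx' _ ⟨p, ⟨hp, h0⟩, rfl⟩)
    · simpa [h0] using h _ (Or.inl ⟨p, ⟨hp, h0⟩, rfl⟩)
    · exact (key p x h0).2 (hx _ ⟨p, ⟨hp, h0⟩, rfl⟩)

/-- Fourier–Motzkin elimination of `r` unknowns from a system of strict inequalities. -/
noncomputable def posElimVec {W : Type*} [AddCommGroup W] [Module ℚ W] :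
    ∀ r : ℕ, List (W × (Fin r → ℚ)) → List W
  | 0, l => l.map Prod.fst
  | r + 1, l => posElimVec r (posElim (l.map fun p => ((p.1, Fin.tail p.2), p.2 0)))

theorem exists_iff_posElimVec {W : Type*} [AddCommGroup W] [Module ℚ W] (e : W →ₗ[ℚ] M) :
    ∀ (r : ℕ) (l : List (W × (Fin r → ℚ))),
      (∃ z : Fin r → M, ∀ p ∈ l, 0 < e p.1 + ∑ k, p.2 k • z k) ↔ ∀ w ∈ posElimVec r l, 0 < e w
  | 0, l => by simp [posElimVec]
  | r + 1, l => by
    rw [posElimVec, ← exists_iff_posElimVec e r, Fin.exists_fin_succ_pi, exists_comm]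
    refine exists_congr fun z => ?_
    -- With the other unknowns `z` held fixed, a form together with their coefficients is evaluated
    -- by a single linear map, so the step for one unknown applies.
    have := exists_iff_posElim (M := M) (l.map fun p => ((p.1, Fin.tail p.2), p.2 0))
      (e.coprod (∑ k, (LinearMap.toSpanSingleton ℚ M (z k)).comp (LinearMap.proj k)))
    simp only [List.mem_map, forall_exists_index, and_imp, forall_apply_eq_imp_iff₂,
      LinearMap.coprod_apply, LinearMap.sum_apply, LinearMap.comp_apply, LinearMap.proj_apply,
      LinearMap.toSpanSingleton_apply] at this
    rw [← this]
    refine exists_congr fun x => forall₂_congr fun p _ => ?_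
    rw [Fin.sum_univ_succ]
    simp only [Fin.cons_zero, Fin.cons_succ, Fin.tail]
    rw [add_assoc, add_comm (p.2 0 • x)]

end FourierMotzkin

/-! ### Disjunctive normal forms -/

section DNF

/-- A quantifier-free condition, in disjunctive normal form: a list of systems of equations
`w = 0` and inequalities `0 < w`. -/
abbrev DNF (W : Type*) := List (List W × List W)

namespace DNF

variable {W W' : Type*} {M : Type*}

/-- The system `C` holds at the evaluation `e`. -/
def Clause [Zero M] [LT M] (C : List W × List W) (e : W → M) : Prop :=
  (∀ w ∈ C.1, e w = 0) ∧ ∀ w ∈ C.2, 0 < e w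

/-- The condition `F` holds at the evaluation `e`. -/
def Holds [Zero M] [LT M] (F : DNF W) (e : W → M) : Prop :=
  ∃ C ∈ F, Clause C e

/-- Rewriting the atoms. -/
def mapAtoms (f : W → W') (F : DNF W) : DNF W' := F.map fun C => (C.1.map f, C.2.map f)

/-- Conjunction. -/
def conj (F G : DNF W) : DNF W := F.flatMap fun C => G.map fun D => (C.1 ++ D.1, C.2 ++ D.2)

/-- The negation of a system of equations and inequalities. -/
def negClause [Neg W] (C : List W × List W) : DNF W :=
  (C.1.map fun w => ([], [w])) ++ (C.1.map fun w => ([], [-w])) ++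
    (C.2.map fun w => ([w], [])) ++ C.2.map fun w => ([], [-w])

/-- Negation. -/
def neg [Neg W] : DNF W → DNF W
  | [] => [([], [])]
  | C :: F => conj (negClause C) (neg F)

section

variable [Zero M] [LT M] {e : W → M}

@[simp]
theorem holds_nil : ¬ Holds ([] : DNF W) e := by simp [Holds]

theorem clause_eq {w : W} : Clause ([w], []) e ↔ e w = 0 := by simp [Clause]

theorem clause_pos {w : W} : Clause ([], [w]) e ↔ 0 < e w := by simp [Clause]

theorem holds_cons {C : List W × List W} {F : DNF W} :
    Holds (C :: F) e ↔ Clause C e ∨ Holds F e := by simp [Holds]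

theorem holds_append {F G : DNF W} : Holds (F ++ G) e ↔ Holds F e ∨ Holds G e := by
  simp [Holds, or_and_right, exists_or]

theorem holds_conj {F G : DNF W} : Holds (conj F G) e ↔ Holds F e ∧ Holds G e := by
  simp only [Holds, conj, Clause, List.mem_flatMap, List.mem_map]
  constructor
  · rintro ⟨_, ⟨C, hC, D, hD, rfl⟩, h1, h2⟩
    simp only [List.mem_append, or_imp, forall_and] at h1 h2
    exact ⟨⟨C, hC, h1.1, h2.1⟩, D, hD, h1.2, h2.2⟩
  · rintro ⟨⟨C, hC, h1, h2⟩, D, hD, h3, h4⟩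
    refine ⟨_, ⟨C, hC, D, hD, rfl⟩, ?_, ?_⟩ <;>
      simp only [List.mem_append, or_imp, forall_and] <;> tauto

theorem holds_mapAtoms {f : W → W'} {F : DNF W} {e : W' → M} :
    Holds (mapAtoms f F) e ↔ Holds F (fun w => e (f w)) := by
  simp [Holds, mapAtoms, Clause]

end

/-- The order is linear, so `w ≠ 0` splits into `0 < w` or `0 < -w`, and the failure of `0 < w` into
`w = 0` or `0 < -w`; no other kind of atom is needed. -/
theorem holds_neg [AddCommGroup W] [AddCommGroup M] [LinearOrder M] [IsOrderedAddMonoid M]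
    {E : Type*} [FunLike E W M] [AddMonoidHomClass E W M] (e : E) (F : DNF W) :
    Holds (neg F) e ↔ ¬ Holds F e := by
  have h : ∀ C : List W × List W, Holds (negClause C) e ↔ ¬ Clause C e := by
    intro C
    have h1 : (¬ ∀ w ∈ C.1, e w = 0) ↔ (∃ w ∈ C.1, 0 < e w) ∨ ∃ w ∈ C.1, e w < 0 := by
      push Not
      simp only [← exists_or, ← and_or_left]
      exact exists_congr fun w => and_congr_right fun _ => by rw [ne_iff_lt_or_gt, or_comm]
    have h2 : (¬ ∀ w ∈ C.2, 0 < e w) ↔ (∃ w ∈ C.2, e w = 0) ∨ ∃ w ∈ C.2, e w < 0 := by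
      push Not
      simp only [← exists_or, ← and_or_left]
      exact exists_congr fun w => and_congr_right fun _ => by rw [le_iff_eq_or_lt]
    rw [Clause, not_and_or, h1, h2]
    simp [negClause, Holds, Clause, or_and_right, exists_or, or_assoc]
  induction F with
  | nil => simp [neg, Holds, Clause]
  | cons C F ih => rw [neg, holds_conj, h, holds_cons, not_or]; exact and_congr Iff.rfl ih

end DNF

end DNF

/-! ### Continuity of rational scalars, and boxes -/

section Topology

variable {M : Type*} [AddCommGroup M] [LinearOrder M] [IsOrderedAddMonoid M] [Module ℚ M]

/-- For `r > 0` the map is an increasing bijection. This argument is special to ℚ: multiplication by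
a general element of `K` need not be monotone. -/
theorem continuous_rat_smul [TopologicalSpace M] [OrderTopology M] (r : ℚ) :
    Continuous fun x : M => r • x := by
  have hpos : ∀ r : ℚ, 0 < r → Continuous fun x : M => r • x := by
    intro r hr
    have := denselyOrdered_of_ratModule M
    refine Monotone.continuous_of_surjective
      (StrictMono.monotone fun x y h => rat_smul_lt_smul hr h) ?_
    exact fun y => ⟨r⁻¹ • y, smul_inv_smul₀ hr.ne' y⟩
  rcases lt_trichotomy r 0 with h | h | h
  · exact (hpos (-r) (neg_pos.2 h)).neg.congr fun x => by simp
  · simpa [h] using continuous_const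
  · exact hpos r h

omit [Module ℚ M] in
theorem exists_box_subset [Nontrivial M] [TopologicalSpace M] [OrderTopology M] {ι : Type*}
    [Finite ι] {U : Set (ι → M)} (hU : IsOpen U) {z : ι → M} (hz : z ∈ U) :
    ∃ a b : ι → M, (∀ i, a i < z i ∧ z i < b i) ∧
      ∀ y : ι → M, (∀ i, a i < y i ∧ y i < b i) → y ∈ U := by
  have h1 := hU.mem_nhds hz
  rw [nhds_pi, Filter.mem_pi'] at h1
  obtain ⟨I, t, ht, hs⟩ := h1
  choose a b hab hsub using fun i => mem_nhds_iff_exists_Ioo_subset.1 (ht i)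
  exact ⟨a, b, hab, fun y hy => hs fun i _ => hsub i (hy i)⟩

end Topology

/-! ### Scalars with dense images -/

section Scalars

/-- The scalar multiplications of a `K`-vector space with an order have dense images: if
`q₁, …, qₘ` are linearly independent over `ℚ` then the image of `x ↦ (q₁ x, …, qₘ x)` is
dense. -/
class DenseScalars (K M : Type*) [Field K] [CharZero K] [AddCommGroup M] [LinearOrder M]
    [Module K M] : Prop where
  dense : ∀ {m : ℕ} (q : Fin m → K), LinearIndependent ℚ q → ∀ a b : Fin m → M,
    (∀ i, a i < b i) → ∃ x : M, ∀ i, a i < q i • x ∧ q i • x < b i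

instance denseScalars_rat (M : Type*) [AddCommGroup M] [LinearOrder M] [IsOrderedAddMonoid M]
    [Module ℚ M] : DenseScalars ℚ M where
  dense := by
    intro m q hq a b hab
    have := denselyOrdered_of_ratModule M
    -- Since ℚ has dimension 1 over itself, only tuples of length 0 or 1 have to be considered.
    have hm : m ≤ 1 := by simpa using hq.fintype_card_le_finrank
    obtain rfl | rfl : m = 0 ∨ m = 1 := by omega
    · exact ⟨0, fun i => i.elim0⟩
    · obtain ⟨y, hy⟩ := exists_between (hab 0)
      have h0 : q 0 ≠ 0 := hq.ne_zero 0
      refine ⟨(q 0)⁻¹ • y, fun i => ?_⟩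
      rw [Subsingleton.elim i 0, smul_inv_smul₀ h0]
      exact hy

theorem exists_rat_coordinates {K : Type*} [AddCommGroup K] [Module ℚ K] (s : Finset K) :
    ∃ (r : ℕ) (p : Fin r → K) (c : K → Fin r → ℚ), LinearIndependent ℚ p ∧
      ∀ q ∈ s, q = ∑ k, c q k • p k := by
  let V := Submodule.span ℚ (s : Set K)
  let b := Module.finBasis ℚ V
  classical
  -- Outside the span of `s` the coordinates are the arbitrary value 0, which is never used.
  refine ⟨_, fun k => (b k : K), fun q k => if h : q ∈ V then b.repr ⟨q, h⟩ k else 0, ?_, ?_⟩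
  · exact b.linearIndependent.map' V.subtype (Submodule.ker_subtype V)
  · intro q hq
    have hV : q ∈ V := Submodule.subset_span hq
    have := congrArg V.subtype (b.sum_repr ⟨q, hV⟩)
    simp only [map_sum, map_smul, Submodule.subtype_apply] at this
    simp only [dif_pos hV]
    exact this.symm

variable {K M : Type*} [Field K] [CharZero K] [AddCommGroup M] [LinearOrder M]
  [IsOrderedAddMonoid M] [Module ℚ M] [Module K M] [Nontrivial M] [DenseScalars K M]

omit [Module ℚ M] in
theorem denseRange_scalars [TopologicalSpace M] [OrderTopology M] {r : ℕ} {p : Fin r → K}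
    (hp : LinearIndependent ℚ p) : DenseRange fun (x : M) (k : Fin r) => p k • x := by
  intro z
  rw [mem_closure_iff]
  intro U hU hz
  obtain ⟨a, b, h1, h2⟩ := exists_box_subset hU hz
  obtain ⟨x, hx⟩ := DenseScalars.dense (M := M) p hp a b fun i => (h1 i).1.trans (h1 i).2
  exact ⟨_, h2 _ hx, x, rfl⟩

omit [LinearOrder M] [IsOrderedAddMonoid M] [Nontrivial M] [DenseScalars K M] in
theorem smul_eq_sum_smul {r : ℕ} {p : Fin r → K} {c : Fin r → ℚ} {q : K}
    (h : q = ∑ k, c k • p k) (x : M) : q • x = ∑ k, c k • (p k • x) := by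
  rw [h, Finset.sum_smul]
  simp only [smul_assoc]

/-- The solutions `z` form an open set because the inequalities are strict and their coefficients
rational; if it is nonempty, it meets the dense set of tuples `p k • x`. -/
theorem exists_scalars_iff {r : ℕ} {p : Fin r → K} (hp : LinearIndependent ℚ p)
    (l : List (M × (Fin r → ℚ))) :
    (∃ x : M, ∀ w ∈ l, 0 < w.1 + ∑ k, w.2 k • (p k • x)) ↔
      ∃ z : Fin r → M, ∀ w ∈ l, 0 < w.1 + ∑ k, w.2 k • z k := by
  refine ⟨fun ⟨x, hx⟩ => ⟨fun k => p k • x, hx⟩, fun ⟨z, hz⟩ => ?_⟩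
  let _ : TopologicalSpace M := Preorder.topology M
  have : OrderTopology M := ⟨rfl⟩
  have hO : IsOpen {z : Fin r → M | ∀ w ∈ l, 0 < w.1 + ∑ k, w.2 k • z k} := by
    have : {z : Fin r → M | ∀ w ∈ l, 0 < w.1 + ∑ k, w.2 k • z k} =
        ⋂ w ∈ l.toFinset, {z : Fin r → M | 0 < w.1 + ∑ k, w.2 k • z k} := by ext; simp
    rw [this]
    refine isOpen_biInter_finset fun w _ => isOpen_lt continuous_const ?_
    exact continuous_const.add
      (continuous_finsetSum _ fun k _ => (continuous_rat_smul _).comp (continuous_apply k))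
  obtain ⟨_, h, x, rfl⟩ := (denseRange_scalars (M := M) hp).inter_open_nonempty _ hO ⟨z, hz⟩
  exact ⟨x, h⟩

end Scalars

/-! ### Elimination of one existential quantifier -/

namespace DNF

section Elimination

variable {K : Type*} [Field K] [CharZero K] {W : Type*} [AddCommGroup W] [Module K W] [Module ℚ W]

open Classical in
/-- Elimination of `x` from a system of equations `w + q • x = 0` and inequalities
`0 < w + q • x`. -/
noncomputable def exClause (C : List (W × K) × List (W × K)) : List W × List W :=
  if h : ∃ p ∈ C.1, p.2 ≠ 0 then
    (C.1.map fun w => w.1 - (w.2 * h.choose.2⁻¹) • h.choose.1,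
      C.2.map fun w => w.1 - (w.2 * h.choose.2⁻¹) • h.choose.1)
  else
    (C.1.map Prod.fst,
      -- The rational coordinates are chosen from the scalars in `C` alone. The eliminated system
      -- thus does not depend on the model, which completeness will use.
      posElimVec _ (C.2.map fun w =>
        (w.1, (exists_rat_coordinates (C.2.map Prod.snd).toFinset).choose_spec.choose_spec.choose
          w.2)))

/-- Elimination of one existentially quantified variable. -/
noncomputable def ex (F : DNF (W × K)) : DNF W := F.map exClause

variable {M : Type*} [AddCommGroup M] [LinearOrder M]
  [IsOrderedAddMonoid M] [Module ℚ M] [Module K M] [Nontrivial M] [DenseScalars K M]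

theorem clause_exClause (C : List (W × K) × List (W × K)) (e : W →ₗ[K] M) :
    Clause (exClause C) e ↔ ∃ x : M, Clause C fun w => e w.1 + w.2 • x := by
  classical
  by_cases h : ∃ p ∈ C.1, p.2 ≠ 0
  · rw [exClause, dif_pos h]
    obtain ⟨hp, h0⟩ := h.choose_spec
    generalize h.choose = p at hp h0
    have key : ∀ (w : W × K) (x : M), x = -(p.2⁻¹ • e p.1) →
        e (w.1 - (w.2 * p.2⁻¹) • p.1) = e w.1 + w.2 • x := by
      rintro w x rfl
      rw [map_sub, map_smul, mul_smul, smul_neg, sub_eq_add_neg]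
    have sol : ∀ x : M, e p.1 + p.2 • x = 0 → x = -(p.2⁻¹ • e p.1) := by
      intro x hx
      rw [eq_neg_of_add_eq_zero_left hx, smul_neg, inv_smul_smul₀ h0, neg_neg]
    simp only [Clause, List.mem_map, forall_exists_index, and_imp, forall_apply_eq_imp_iff₂]
    constructor
    · rintro ⟨h1, h2⟩
      refine ⟨-(p.2⁻¹ • e p.1), fun w hw => ?_, fun w hw => ?_⟩
      · rw [← key w _ rfl]; exact h1 w hw
      · rw [← key w _ rfl]; exact h2 w hw
    · rintro ⟨x, h1, h2⟩
      have hx := sol x (h1 p hp)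
      refine ⟨fun w hw => ?_, fun w hw => ?_⟩
      · rw [key w x hx]; exact h1 w hw
      · rw [key w x hx]; exact h2 w hw
  · rw [exClause, dif_neg h]
    obtain ⟨hp, hc⟩ := (exists_rat_coordinates
      (C.2.map Prod.snd).toFinset).choose_spec.choose_spec.choose_spec
    set c := (exists_rat_coordinates (C.2.map Prod.snd).toFinset).choose_spec.choose_spec.choose
    set p := (exists_rat_coordinates (C.2.map Prod.snd).toFinset).choose_spec.choose
    push Not at h
    -- The elimination runs over ℚ, and additivity of `e` alone makes it ℚ-linear.
    have h1 := exists_iff_posElimVec (M := M) (e.toAddMonoidHom.toRatLinearMap) _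
      (C.2.map fun w => (w.1, c w.2))
    have h2 := exists_scalars_iff (M := M) hp (C.2.map fun w => (e w.1, c w.2))
    simp only [List.mem_map, forall_exists_index, and_imp, forall_apply_eq_imp_iff₂,
      AddMonoidHom.coe_toRatLinearMap, LinearMap.toAddMonoidHom_coe] at h1 h2
    simp only [Clause, List.mem_map, forall_exists_index, and_imp, forall_apply_eq_imp_iff₂]
    rw [← h1, ← h2, ← exists_and_left]
    refine exists_congr fun x => and_congr ?_ ?_
    · exact forall₂_congr fun w hw => by rw [h w hw, zero_smul, add_zero]
    · refine forall₂_congr fun w hw => ?_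
      rw [smul_eq_sum_smul (hc w.2 (by simpa using ⟨w.1, hw⟩))]

theorem holds_ex (F : DNF (W × K)) (e : W →ₗ[K] M) :
    Holds (ex F) e ↔ ∃ x : M, Holds F fun w => e w.1 + w.2 • x := by
  simp only [Holds, ex, List.mem_map, exists_exists_and_eq_and, clause_exClause]
  rw [exists_comm]
  simp only [exists_and_left]

end Elimination

end DNF

/-! ### Quantifier elimination for linear languages -/

section LinearLanguages

/-- A language whose function symbols are interpreted as affine maps over `K`, and whose relation
symbols are interpreted as instances of the order. -/
class LinearLang (L : FirstOrder.Language.{u, v}) (K : Type*) where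
  coef : ∀ {n : ℕ}, L.Functions n → Fin n → K
  const : ∀ {n : ℕ}, L.Functions n → K
  rel : ∀ {n : ℕ}, L.Relations n → Fin n × Fin n

/-- The symbols of the language have in `M` their intended interpretation, with `one` as the
distinguished element. -/
class LinearStructure (L : FirstOrder.Language.{u, v}) (K : Type*) [LinearLang L K] {M : Type*}
    [L.Structure M] [LE M] [AddCommMonoid M] [SMul K M] (one : M) : Prop where
  funMap_eq : ∀ {n : ℕ} (f : L.Functions n) (x : Fin n → M),
    Structure.funMap f x = ∑ i, LinearLang.coef (K := K) f i • x i +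
      LinearLang.const (K := K) f • one
  relMap_iff : ∀ {n : ℕ} (R : L.Relations n) (x : Fin n → M),
    Structure.RelMap R x ↔ x (LinearLang.rel K R).1 ≤ x (LinearLang.rel K R).2

/-- Affine forms in free variables from `α` and `n` further variables. -/
abbrev Form (K α : Type*) [Field K] (n : ℕ) := ((α →₀ K) × K) × (Fin n → K)

variable {L : FirstOrder.Language.{u, v}} {K : Type*} [Field K] {α : Type*}

/-- The value of an affine form. -/
noncomputable def Form.eval {M : Type*} [AddCommGroup M] [Module K M] (one : M) {n : ℕ}
    (a : α → M) (x : Fin n → M) : Form K α n →ₗ[K] M :=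
  ((Finsupp.linearCombination K a).coprod (LinearMap.toSpanSingleton K M one)).coprod
    (∑ i, (LinearMap.toSpanSingleton K M (x i)).comp (LinearMap.proj i))

theorem Form.eval_apply {M : Type*} [AddCommGroup M] [Module K M] (one : M) {n : ℕ}
    (a : α → M) (x : Fin n → M) (w : Form K α n) :
    Form.eval one a x w =
      Finsupp.linearCombination K a w.1.1 + w.1.2 • one + ∑ i, w.2 i • x i := by
  simp [Form.eval]

variable [LinearLang L K]

/-- The affine form given by a term. -/
noncomputable def termForm {n : ℕ} : L.Term (α ⊕ Fin n) → Form K α n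
  | .var (.inl a) => ((Finsupp.single a 1, 0), 0)
  | .var (.inr i) => ((0, 0), Pi.single i 1)
  | .func f ts =>
    ∑ i, LinearLang.coef (L := L) (K := K) f i • termForm (ts i) + ((0, LinearLang.const f), 0)

theorem realize_eq_eval_termForm {M : Type*} [L.Structure M] [AddCommGroup M] [LinearOrder M]
    [Module K M] (one : M) [LinearStructure L K one] {n : ℕ}
    (a : α → M) (x : Fin n → M) (t : L.Term (α ⊕ Fin n)) :
    t.realize (Sum.elim a x) = Form.eval one a x (termForm (K := K) t) := by
  induction t with
  | var s =>
    rcases s with s | i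
    · simp [termForm, Form.eval_apply]
    · simp [termForm, Form.eval_apply, Pi.single_apply]
  | func f ts ih =>
    rw [Term.realize_func, LinearStructure.funMap_eq (K := K) (one := one), termForm, map_add,
      map_sum]
    simp only [map_smul, ih]
    simp [Form.eval_apply]

/-- Separating the last variable of a form. -/
def Form.split {n : ℕ} (w : Form K α (n + 1)) : Form K α n × K :=
  ((w.1, Fin.init w.2), w.2 (Fin.last n))

theorem Form.eval_split {M : Type*} [AddCommGroup M] [Module K M] (one : M) {n : ℕ}
    (a : α → M) (x : Fin n → M) (y : M) (w : Form K α (n + 1)) :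
    Form.eval one a x (Form.split w).1 + (Form.split w).2 • y =
      Form.eval one a (Fin.snoc x y) w := by
  simp only [Form.eval_apply, Form.split, Fin.sum_univ_castSucc, Fin.snoc_castSucc, Fin.snoc_last,
    Fin.init, add_assoc]

variable [CharZero K]

/-- Quantifier elimination: a quantifier-free condition equivalent to a formula. -/
noncomputable def qfForm : ∀ {n : ℕ}, L.BoundedFormula α n → DNF (Form K α n)
  | _, .falsum => []
  | _, .equal t₁ t₂ => [([termForm t₁ - termForm t₂], [])]
  | _, .rel R ts =>
    [([termForm (ts (LinearLang.rel K R).2) - termForm (ts (LinearLang.rel K R).1)], []),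
      ([], [termForm (ts (LinearLang.rel K R).2) - termForm (ts (LinearLang.rel K R).1)])]
  | _, .imp φ ψ => (qfForm φ).neg ++ qfForm ψ
  -- A universal quantifier is treated as a negated existential one.
  | _, .all φ => (DNF.ex ((qfForm φ).neg.mapAtoms Form.split)).neg

theorem realize_iff_holds_qfForm {M : Type*} [L.Structure M] [AddCommGroup M] [LinearOrder M]
    [IsOrderedAddMonoid M] [Module ℚ M] [Module K M] [Nontrivial M] [DenseScalars K M] (one : M)
    [LinearStructure L K one] {n : ℕ} (φ : L.BoundedFormula α n) (a : α → M) (x : Fin n → M) :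
    φ.Realize a x ↔ (qfForm (K := K) φ).Holds (Form.eval one a x) := by
  induction φ with
  | falsum => simp [qfForm, BoundedFormula.Realize]
  | equal t₁ t₂ =>
    rw [qfForm, DNF.holds_cons, DNF.clause_eq, map_sub, sub_eq_zero,
      ← realize_eq_eval_termForm (K := K) one, ← realize_eq_eval_termForm (K := K) one]
    simp [BoundedFormula.Realize]
  | rel R ts =>
    rw [BoundedFormula.Realize, LinearStructure.relMap_iff (K := K) (one := one)]
    rw [qfForm, DNF.holds_cons, DNF.holds_cons, DNF.clause_eq, DNF.clause_pos, map_sub, sub_eq_zero,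
      sub_pos, realize_eq_eval_termForm (K := K) one, realize_eq_eval_termForm (K := K) one,
      le_iff_eq_or_lt]
    simp [eq_comm]
  | imp φ ψ h1 h2 =>
    rw [BoundedFormula.realize_imp, qfForm, DNF.holds_append, DNF.holds_neg, h1, h2,
      imp_iff_not_or]
  | all φ ih =>
    rw [BoundedFormula.realize_all, qfForm, DNF.holds_neg, DNF.holds_ex, not_exists]
    refine forall_congr' fun y => ?_
    rw [DNF.holds_mapAtoms, ih]
    simp only [Form.eval_split]
    rw [DNF.holds_neg, not_not]

end LinearLanguages

/-! ### Definable sets and definable closure -/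

section DefinableSets

variable {L : FirstOrder.Language.{u, v}} {K : Type*} [Field K] [CharZero K] [LinearLang L K]
  {M : Type*} [L.Structure M] [AddCommGroup M] [LinearOrder M]
  [IsOrderedAddMonoid M] [Module ℚ M] [Module K M] [Nontrivial M] [DenseScalars K M] (one : M)
  [LinearStructure L K one] {β : Type*} [Fintype β]

/-- The value at `x` of an affine form with coefficients in `K` and constant term in `M`. -/
def affine {K M : Type*} [Field K] [AddCommGroup M] [Module K M] (x : β → M)
    (w : (β → K) × M) : M := ∑ i, w.1 i • x i + w.2

theorem affine_fin_one {K M : Type*} [Field K] [AddCommGroup M] [Module K M] (x : M)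
    (w : (Fin 1 → K) × M) : affine (fun _ : Fin 1 => x) w = w.1 0 • x + w.2 := by
  simp [affine]

omit [CharZero K] [LinearOrder M] [IsOrderedAddMonoid M] [Module ℚ M] [Nontrivial M] in
theorem linearCombination_sumElim {ι : Type*} (a : ι → M) (x : β → M) (w : (ι ⊕ β) →₀ K) :
    Finsupp.linearCombination K (Sum.elim a x) w =
      Finsupp.linearCombination K (Sum.elim a 0) w + ∑ i, w (Sum.inr i) • x i := by
  classical
  induction w using Finsupp.induction_linear with
  | zero => simp
  | add f g hf hg =>
    simp only [map_add, hf, hg, Finsupp.add_apply, add_smul, Finset.sum_add_distrib]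
    abel
  | single s q =>
    rcases s with s | s
    · simp
    · simp [Finsupp.single_apply, ite_smul]

/-- Parameters are free variables of the formula; evaluating them absorbs their part of each form
into its constant term. Keeping that constant in the span of `A` and `one` is what bounds `dcl`. -/
theorem exists_dnf_of_definable {A : Set M} {S : Set (β → M)} (hS : A.Definable L S) :
    ∃ F : DNF ((β → K) × M),
      (∀ C ∈ F, ∀ w : (β → K) × M, w ∈ C.1 ∨ w ∈ C.2 → w.2 ∈ Submodule.span K (insert one A)) ∧
      S = {x | F.Holds (affine x)} := by
  obtain ⟨φ, rfl⟩ := Set.definable_iff_exists_formula_sum.1 hS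
  let f : Form K (A ⊕ β) 0 → (β → K) × M := fun w =>
    (fun i => w.1.1 (Sum.inr i),
      Finsupp.linearCombination K (Sum.elim (fun a : A => (a : M)) 0) w.1.1 + w.1.2 • one)
  have hf : ∀ w, (f w).2 ∈ Submodule.span K (insert one A) := by
    intro w
    refine add_mem ?_ (Submodule.smul_mem _ _ (Submodule.subset_span (Set.mem_insert _ _)))
    rw [Finsupp.linearCombination_apply, Finsupp.sum]
    refine Submodule.sum_mem _ fun s _ => Submodule.smul_mem _ _ ?_
    rcases s with s | s
    · exact Submodule.subset_span (Set.mem_insert_of_mem _ s.2)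
    · exact zero_mem _
  refine ⟨(qfForm (K := K) φ).mapAtoms f, ?_, ?_⟩
  · simp only [DNF.mapAtoms, List.mem_map, forall_exists_index, and_imp, forall_apply_eq_imp_iff₂]
    rintro C - _ (⟨w, -, rfl⟩ | ⟨w, -, rfl⟩) <;> exact hf w
  · ext x
    rw [Set.mem_ofPred_eq, Formula.Realize, realize_iff_holds_qfForm (K := K) one, Set.mem_ofPred_eq,
      DNF.holds_mapAtoms]
    have : (Form.eval one (Sum.elim (fun a : A => (a : M)) x) default : Form K (A ⊕ β) 0 → M) =
        fun w => affine x (f w) := by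
      ext w
      rw [Form.eval_apply, linearCombination_sumElim]
      simp only [affine, f, Finset.univ_eq_empty, Finset.sum_empty]
      abel
    rw [← this]

-- The conditions on `x` need not be open, since scalars from `K` need not be continuous, but they
-- pull back from an open set of tuples under `x ↦ (p j • x)`. Density gives a solution whose `k`-th
-- coordinate differs from that of `b`.
omit [Module ℚ M] in
theorem exists_ne_of_forall_pos (l : List (K × M)) (b : M) (hb : ∀ w ∈ l, 0 < w.1 • b + w.2)  :
    ∃ x ≠ b, ∀ w ∈ l, 0 < w.1 • x + w.2 := by
  classical
  let _ : Module ℚ M := Module.compHom M (algebraMap ℚ K)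
  let _ : TopologicalSpace M := Preorder.topology M
  have : OrderTopology M := ⟨rfl⟩
  have := denselyOrdered_of_ratModule M
  -- The scalar 1 is included to force `r ≠ 0`, so that a coordinate is available to separate `x`
  -- from `b`, even when `l` is empty.
  obtain ⟨r, p, c, hp, hc⟩ := exists_rat_coordinates (insert 1 (l.map Prod.fst).toFinset : Finset K)
  have hr : r ≠ 0 := by
    rintro rfl
    exact one_ne_zero ((hc 1 (Finset.mem_insert_self _ _)).trans Finset.sum_empty)
  let k : Fin r := ⟨0, Nat.pos_of_ne_zero hr⟩
  let O : Set (Fin r → M) := {z | ∀ w ∈ l, 0 < ∑ j, c w.1 j • z j + w.2}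
  have hO : IsOpen O := by
    have : O = ⋂ w ∈ l.toFinset, {z : Fin r → M | 0 < ∑ j, c w.1 j • z j + w.2} := by
      ext; simp [O]
    rw [this]
    refine isOpen_biInter_finset fun w _ => isOpen_lt continuous_const ?_
    exact Continuous.add
      (continuous_finsetSum _ fun k _ => (continuous_rat_smul _).comp (continuous_apply k))
      continuous_const
  have hmem : ∀ x : M, (fun j => p j • x) ∈ O ↔ ∀ w ∈ l, 0 < w.1 • x + w.2 := by
    intro x
    refine forall₂_congr fun w hw => ?_
    rw [← smul_eq_sum_smul (hc w.1 (Finset.mem_insert_of_mem (by simpa using ⟨w.2, hw⟩)))]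
  have hz := (hmem b).2 hb
  obtain ⟨s, t, h1, h2⟩ := exists_box_subset hO hz
  obtain ⟨y, hy⟩ := exists_between (h1 k).1
  obtain ⟨_, ⟨hx, hx'⟩, x, rfl⟩ := (denseRange_scalars (M := M) hp).inter_open_nonempty
    (O ∩ {z | z k < p k • b}) (hO.inter (isOpen_lt (continuous_apply k) continuous_const))
    ⟨Function.update (fun j => p j • b) k y, h2 _ fun i => by
      rcases eq_or_ne i k with rfl | hi
      · rw [Function.update_self]; exact ⟨hy.1, hy.2.trans (h1 _).2⟩
      · rw [Function.update_of_ne hi]; exact h1 i, by simpa using hy.2⟩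
  refine ⟨x, ?_, (hmem x).1 hx⟩
  rintro rfl
  exact lt_irrefl _ hx'

/-- If `b` lies outside the span, no equation satisfied by `b` can involve the variable, for it
could be solved for `b`. Only strict inequalities remain, and they have a second solution. -/
theorem dcl_subset_span (A : Set M) : dcl L A ⊆ Submodule.span K (insert one A) := by
  intro b hb
  by_contra hbV
  obtain ⟨F, hF, hS⟩ := exists_dnf_of_definable (K := K) one hb
  have hx : ∀ x : M, x = b ↔ F.Holds (affine fun _ : Fin 1 => x) := fun x =>
    (Set.ext_iff.1 hS fun _ => x)
  obtain ⟨C, hC, h1, h2⟩ := (hx b).1 rfl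
  simp only [affine_fin_one] at h1 h2
  have h0 : ∀ w ∈ C.1, w.1 0 = 0 := by
    intro w hw
    by_contra h
    refine hbV ?_
    have := h1 w hw
    rw [← inv_smul_smul₀ h b, eq_neg_of_add_eq_zero_left this]
    exact Submodule.smul_mem _ _ (neg_mem (hF C hC w (Or.inl hw)))
  obtain ⟨x, hxb, hx'⟩ := exists_ne_of_forall_pos (C.2.map fun w => (w.1 0, w.2)) b
    (by simpa only [List.mem_map, forall_exists_index, and_imp, forall_apply_eq_imp_iff₂] using h2)
  refine hxb ((hx x).2 ⟨C, hC, fun w hw => ?_, fun w hw => ?_⟩)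
  · have := h1 w hw
    rw [affine_fin_one]
    rw [h0 w hw] at this ⊢
    simpa using this
  · rw [affine_fin_one]
    exact hx' _ (List.mem_map.2 ⟨w, hw, rfl⟩)

end DefinableSets

/-! ### Points and intervals: o-minimality over ℚ -/

section OMinimal

variable {M : Type*} [LinearOrder M]

/-- Points and open intervals, possibly unbounded or empty. -/
def IsPointOrInterval (J : Set M) : Prop :=
  (∃ a, J = {a}) ∨ ∃ (a : WithBot M) (b : WithTop M),
    J = {x : M | a < (x : WithBot M) ∧ (x : WithTop M) < b}

theorem IsPointOrInterval.inter {I J : Set M} (hI : IsPointOrInterval I)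
    (hJ : IsPointOrInterval J) : IsPointOrInterval (I ∩ J) := by
  have hpt : ∀ (a : M) (J : Set M), IsPointOrInterval ({a} ∩ J) := by
    intro a J
    by_cases h : a ∈ J
    · exact Or.inl ⟨a, by simpa using h⟩
    -- The empty intersection counts as the interval from `a` to `a`.
    · refine Or.inr ⟨a, a, ?_⟩
      rw [Set.singleton_inter_eq_empty.2 h]
      ext x
      simp only [Set.mem_empty_iff_false, Set.mem_ofPred_eq, WithBot.coe_lt_coe, WithTop.coe_lt_coe,
        false_iff, not_and]
      exact fun h => h.not_gt
  rcases hI with ⟨a, rfl⟩ | ⟨a, b, rfl⟩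
  · exact hpt a J
  · rcases hJ with ⟨c, rfl⟩ | ⟨c, d, rfl⟩
    · rw [Set.inter_comm]; exact hpt c _
    · refine Or.inr ⟨max a c, min b d, ?_⟩
      ext x
      simp only [Set.mem_inter_iff, Set.mem_ofPred_eq, max_lt_iff, lt_min_iff]
      tauto

theorem isPointOrInterval_univ : IsPointOrInterval (Set.univ : Set M) :=
  Or.inr ⟨⊥, ⊤, by ext x; simp [WithBot.bot_lt_coe, WithTop.coe_lt_top]⟩

variable [AddCommGroup M] [IsOrderedAddMonoid M] [Module ℚ M]

omit [IsOrderedAddMonoid M] [Module ℚ M] in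
theorem isPointOrInterval_empty : IsPointOrInterval (∅ : Set M) :=
  Or.inr ⟨((0 : M) : WithBot M), ((0 : M) : WithTop M), by
    ext x; simpa using fun h : 0 < x => h.le⟩

omit [IsOrderedAddMonoid M] in
theorem isPointOrInterval_setOf_eq_zero (q : ℚ) (c : M) :
    IsPointOrInterval {x : M | q • x + c = 0} := by
  rcases eq_or_ne q 0 with rfl | hq
  · by_cases hc : c = 0
    · simpa [hc] using isPointOrInterval_univ
    · simpa [hc] using isPointOrInterval_empty
  · refine Or.inl ⟨-(q⁻¹ • c), ?_⟩
    ext x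
    rw [Set.mem_ofPred_eq, Set.mem_singleton_iff, add_eq_zero_iff_eq_neg, ← smul_neg,
      eq_inv_smul_iff₀ hq]

theorem isPointOrInterval_setOf_pos (q : ℚ) (c : M) :
    IsPointOrInterval {x : M | 0 < q • x + c} := by
  rcases lt_trichotomy q 0 with hq | rfl | hq
  · refine Or.inr ⟨⊥, ((-q⁻¹ • c : M) : WithTop M), ?_⟩
    ext x
    simp only [Set.mem_ofPred_eq, WithBot.bot_lt_coe, WithTop.coe_lt_coe, true_and]
    rw [← rat_smul_lt_smul_iff (x := x) (neg_pos.2 hq), smul_smul, neg_mul_neg,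
      mul_inv_cancel₀ hq.ne, one_smul, neg_smul, neg_lt_iff_pos_add']
  · by_cases hc : 0 < c
    · simpa [hc] using isPointOrInterval_univ
    · simpa [hc] using isPointOrInterval_empty
  · refine Or.inr ⟨((-(q⁻¹ • c) : M) : WithBot M), ⊤, ?_⟩
    ext x
    simp only [Set.mem_ofPred_eq, WithTop.coe_lt_top, WithBot.coe_lt_coe, and_true]
    rw [← rat_smul_lt_smul_iff (x := -(q⁻¹ • c)) hq, smul_neg, smul_inv_smul₀ hq.ne',
      neg_lt_iff_pos_add]

theorem isPointOrInterval_clause (C : List ((Fin 1 → ℚ) × M) × List ((Fin 1 → ℚ) × M)) :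
    IsPointOrInterval {x : M | DNF.Clause C (affine fun _ : Fin 1 => x)} := by
  have hall : ∀ (l : List ((Fin 1 → ℚ) × M)) (P : M → (Fin 1 → ℚ) × M → Prop),
      (∀ w, IsPointOrInterval {x : M | P x w}) → IsPointOrInterval {x | ∀ w ∈ l, P x w} := by
    intro l P hP
    induction l with
    | nil => simpa using isPointOrInterval_univ
    | cons w l ih =>
      simp only [List.forall_mem_cons]
      exact (hP w).inter ih
  refine IsPointOrInterval.inter (hall C.1 _ fun w => ?_) (hall C.2 _ fun w => ?_)
  · simpa only [affine_fin_one] using isPointOrInterval_setOf_eq_zero (w.1 0) w.2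
  · simpa only [affine_fin_one] using isPointOrInterval_setOf_pos (w.1 0) w.2

end OMinimal

section OrderSymbol

variable {L : FirstOrder.Language.{u, v}} [L.IsOrdered] {M : Type*} [L.Structure M]
  [LinearOrder M] [L.OrderedStructure M]

theorem sLt_iff {a b : M} : SLt L a b ↔ a < b := by
  simp only [SLt, relMap_leSymb]
  exact lt_iff_le_not_ge.symm

variable (L M) in
theorem orderTop_eq : orderTop L M = Preorder.topology M := by
  simp only [orderTop, sLt_iff]
  rfl

theorem IsPointOrInterval.isOpenInterval {J : Set M} (hJ : IsPointOrInterval J) :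
    (∃ a, J = {a}) ∨ IsOpenInterval L J := by
  refine hJ.imp id ?_
  rintro ⟨a, b, rfl⟩
  simp only [IsOpenInterval, sLt_iff]
  induction a using WithBot.recBotCoe <;> induction b using WithTop.recTopCoe
  · exact Or.inr (Or.inr (Or.inr (by simp [WithBot.bot_lt_coe, WithTop.coe_lt_top])))
  · exact Or.inr (Or.inr (Or.inl ⟨_, by simp [WithBot.bot_lt_coe]; rfl⟩))
  · exact Or.inr (Or.inl ⟨_, by simp [WithTop.coe_lt_top]; rfl⟩)
  · exact Or.inl ⟨_, _, by simp; rfl⟩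

theorem isOMinimal_of_linearStructure [AddCommGroup M] [IsOrderedAddMonoid M] [Module ℚ M]
    [Nontrivial M] [LinearLang L ℚ] (one : M) [LinearStructure L ℚ one] : IsOMinimal L M := by
  intro S hS
  obtain ⟨F, -, hF⟩ := exists_dnf_of_definable (K := ℚ) one hS
  refine ⟨(fun C => {x : M | DNF.Clause C (affine fun _ : Fin 1 => x)}) '' {C | C ∈ F},
    (List.finite_toSet F).image _, ?_, ?_⟩
  · rintro _ ⟨C, -, rfl⟩
    exact (isPointOrInterval_clause C).isOpenInterval
  · ext x
    refine (Set.ext_iff.1 hF fun _ => x).trans ?_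
    simp [DNF.Holds]

end OrderSymbol

/-! ### Closures of definable sets are definable -/

section ClosureDefinable

variable {L : FirstOrder.Language.{u, v}} [L.IsOrdered] {M : Type*} [L.Structure M]
  [LinearOrder M] [L.OrderedStructure M]

theorem definable_setOf_lt {ι : Type*} (i j : ι) :
    (Set.univ : Set M).Definable L {v : ι → M | v i < v j} := by
  refine Set.definable_iff_exists_formula_sum.2
    ⟨Term.lt (Term.var (Sum.inl (Sum.inr i))) (Term.var (Sum.inl (Sum.inr j))), ?_⟩
  ext v
  simp [Formula.Realize, Term.realize_lt]

theorem definable_closure [AddCommGroup M] [IsOrderedAddMonoid M] [Nontrivial M]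
    [TopologicalSpace M] [OrderTopology M] {ι : Type*} [Finite ι] {S : Set (ι → M)}
    (hS : (Set.univ : Set M).Definable L S) : (Set.univ : Set M).Definable L (closure S) := by
  -- Membership in the closure is first-order: every box around `x` meets `S`. The two halves of `u`
  -- are the lower and upper corners of the box, and nested sums of index types carry the point, the
  -- corners and the witness `z`.
  have h : closure S = {x | ∀ u : ι ⊕ ι → M,
      Sum.elim x u ∈ {y : ι ⊕ (ι ⊕ ι) → M | (∀ i, y (.inr (.inl i)) < y (.inl i) ∧
        y (.inl i) < y (.inr (.inr i))) → ∃ z : ι → M, Sum.elim y z ∈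
          {t : (ι ⊕ (ι ⊕ ι)) ⊕ ι → M | (∀ i, t (.inl (.inr (.inl i))) < t (.inr i) ∧
            t (.inr i) < t (.inl (.inr (.inr i)))) ∧ (fun i => t (.inr i)) ∈ S}}} := by
    ext x
    simp only [Set.mem_ofPred_eq, Sum.elim_inl, Sum.elim_inr]
    rw [mem_closure_iff]
    constructor
    · intro hx u hu
      obtain ⟨z, hz, hzS⟩ := hx (⋂ i, {z | u (.inl i) < z i} ∩ {z | z i < u (.inr i)})
        (isOpen_iInter_of_finite fun i =>
          (isOpen_lt continuous_const (continuous_apply i)).inter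
            (isOpen_lt (continuous_apply i) continuous_const)) (by simpa using hu)
      exact ⟨z, by simpa using hz, hzS⟩
    · intro hx U hU hxU
      obtain ⟨a, b, hab, hsub⟩ := exists_box_subset hU hxU
      obtain ⟨z, hz, hzS⟩ := hx (Sum.elim a b) (by simpa using hab)
      exact ⟨z, hsub z (by simpa using hz), hzS⟩
  have hbox : ∀ {γ : Type _} (a c b : ι → γ),
      (Set.univ : Set M).Definable L {y : γ → M | ∀ i, y (a i) < y (c i) ∧ y (c i) < y (b i)} := by
    intro γ a c b
    have : {y : γ → M | ∀ i, y (a i) < y (c i) ∧ y (c i) < y (b i)} =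
        ⋂ i, {y : γ → M | y (a i) < y (c i)} ∩ {y | y (c i) < y (b i)} := by ext; simp
    rw [this]
    exact Set.definable_iInter_of_finite fun i =>
      (definable_setOf_lt _ _).inter (definable_setOf_lt _ _)
  rw [h]
  refine Set.Definable.forall_of_finite ?_
  have h2 := ((hbox (γ := ι ⊕ (ι ⊕ ι)) (fun i => .inr (.inl i)) (fun i => .inl i)
    (fun i => .inr (.inr i))).compl).union (Set.Definable.exists_of_finite
      ((hbox (γ := (ι ⊕ (ι ⊕ ι)) ⊕ ι) (fun i => .inl (.inr (.inl i))) (fun i => .inr i)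
        (fun i => .inl (.inr (.inr i)))).inter (hS.preimage_comp Sum.inr)))
  convert h2 using 1
  ext y
  simp only [Set.mem_union, Set.mem_compl_iff, Set.mem_ofPred_eq, imp_iff_not_or]
  rfl

end ClosureDefinable

/-! ### Parametrizing solutions of linear systems -/

section Parametrization

/-- A solution in `M` is a linear map to `M` from the quotient of `Kⁿ` by the span `U` of the
equations, hence is given by arbitrary values `y` on a basis of that quotient. The matrix `N` holds
the coordinates of the images of the standard basis vectors. -/
theorem exists_parametrization {K : Type*} [Field K] {n : ℕ} (l : List (Fin n → K)) :
    ∃ (d : ℕ) (N : Fin n → Fin d → K), ∀ (M : Type w) [AddCommGroup M] [Module K M] (h : Fin n → M),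
      (∀ u ∈ l, ∑ i, u i • h i = 0) ↔ ∃ y : Fin d → M, ∀ i, h i = ∑ j, N i j • y j := by
  let U : Submodule K (Fin n → K) := Submodule.span K {u | u ∈ l}
  let b := Module.finBasis K ((Fin n → K) ⧸ U)
  refine ⟨_, fun i j => b.repr (U.mkQ (Pi.single i 1)) j, fun M _ _ h => ⟨fun hl => ?_, ?_⟩⟩
  · let H : (Fin n → K) →ₗ[K] M :=
      ∑ i, (LinearMap.toSpanSingleton K M (h i)).comp (LinearMap.proj i)
    have hH : ∀ u, H u = ∑ i, u i • h i := by intro u; simp [H]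
    have hU : U ≤ LinearMap.ker H := Submodule.span_le.2 fun u hu => by
      simpa [hH] using hl u hu
    refine ⟨fun j => U.liftQ H hU (b j), fun i => ?_⟩
    simp only [← map_smul, ← map_sum]
    rw [b.sum_repr, Submodule.mkQ_apply, Submodule.liftQ_apply, hH]
    simp [Pi.single_apply]
  · rintro ⟨y, hy⟩ u hu
    have hu0 : U.mkQ u = 0 := by
      exact (Submodule.Quotient.mk_eq_zero U).2 (Submodule.subset_span hu)
    simp only [hy, Finset.smul_sum, smul_smul]
    rw [Finset.sum_comm]
    refine Finset.sum_eq_zero fun j _ => ?_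
    rw [← Finset.sum_smul]
    have : ∑ i, u i * b.repr (U.mkQ (Pi.single i 1)) j = b.repr (U.mkQ u) j := by
      conv_rhs => rw [← LinearMap.sum_single_apply (fun _ => K) u]
      simp only [map_sum, Finsupp.finsetSum_apply]
      refine Finset.sum_congr rfl fun i _ => ?_
      have : Pi.single i (u i) = u i • (Pi.single i 1 : Fin n → K) := by
        rw [← Pi.single_smul, smul_eq_mul, mul_one]
      rw [this, map_smul, map_smul, Finsupp.smul_apply, smul_eq_mul]
    rw [this, hu0]
    simp

end Parametrization

/-! ### The two languages as linear languages -/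

section Instances

instance (K : Type*) [Field K] : LinearLang LOag K where
  coef _ _ := 1
  const := fun
    | .inl .zero => 0
    | .inl .one => 1
    | .inl .add => 0
  rel := fun
    | .inr .le => (0, 1)

noncomputable instance : LinearLang LQt (RatFunc ℚ) where
  coef := fun
    | .inl f => LinearLang.coef (L := LOag) f
    | .inr (.lam q) => fun _ => q
  const := fun
    | .inl f => LinearLang.const (L := LOag) f
    | .inr _ => 0
  rel := fun
    | .inl R => LinearLang.rel (L := LOag) (RatFunc ℚ) R

end Instances

/-! ### Rational affine functions in the ordered group -/

section RatAffine

variable {M : Type*} [AddCommGroup M] [LinearOrder M] [IsOrderedAddMonoid M] [Module ℚ M]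

/-- The functions `Mᵝ → M` that are affine over `ℚ`, with arbitrary constants. -/
def ratAffine (β M : Type*) [AddCommGroup M] [Module ℚ M] : Submodule ℚ ((β → M) → M) :=
  Submodule.span ℚ (Set.range (fun (i : β) (x : β → M) => x i) ∪ Set.range fun (c : M) _ => c)

omit [LinearOrder M] [IsOrderedAddMonoid M] in
theorem apply_mem_ratAffine {β : Type*} (i : β) :
    (fun x : β → M => x i) ∈ ratAffine β M :=
  Submodule.subset_span (Or.inl ⟨i, rfl⟩)

omit [LinearOrder M] [IsOrderedAddMonoid M] in
theorem const_mem_ratAffine {β : Type*} (c : M) : (fun _ : β → M => c) ∈ ratAffine β M :=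
  Submodule.subset_span (Or.inr ⟨c, rfl⟩)

omit [LinearOrder M] [IsOrderedAddMonoid M] in
theorem sum_smul_mem_ratAffine {β ι : Type*} (s : Finset ι) (c : ι → ℚ) {f : ι → (β → M) → M}
    (hf : ∀ i, f i ∈ ratAffine β M) : (fun x => ∑ i ∈ s, c i • f i x) ∈ ratAffine β M := by
  have := sum_mem (t := s) fun i _ => Submodule.smul_mem (ratAffine β M) (c i) (hf i)
  convert this using 1
  ext x
  simp

theorem continuous_of_mem_ratAffine [TopologicalSpace M] [OrderTopology M] {β : Type*}
    {f : (β → M) → M} (hf : f ∈ ratAffine β M) : Continuous f := by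
  induction hf using Submodule.span_induction with
  | mem f h =>
    rcases h with ⟨i, rfl⟩ | ⟨c, rfl⟩
    · exact continuous_apply i
    · exact continuous_const
  | zero => exact continuous_const
  | add f g _ _ hf hg => exact hf.add hg
  | smul r f _ hf => exact (continuous_rat_smul r).comp hf

variable [LOag.Structure M] (one : M) [LinearStructure LOag ℚ one]

include one

omit [IsOrderedAddMonoid M] in
theorem realize_zeroT {α : Type*} (v : α → M) : (zeroT : LOag.Term α).realize v = 0 := by
  refine (LinearStructure.funMap_eq (L := LOag) (K := ℚ) (one := one)
    (Sum.inl presburgerFunc.zero : LOag.Functions 0) _).trans ?_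
  change ∑ i : Fin 0, (1 : ℚ) • _ + (0 : ℚ) • one = 0
  simp

omit [IsOrderedAddMonoid M] in
theorem realize_addT {α : Type*} (v : α → M) (s t : LOag.Term α) :
    (addT s t).realize v = s.realize v + t.realize v := by
  refine (LinearStructure.funMap_eq (L := LOag) (K := ℚ) (one := one)
    (Sum.inl presburgerFunc.add : LOag.Functions 2) _).trans ?_
  change ∑ i : Fin 2, (1 : ℚ) • (![s, t] i).realize v + (0 : ℚ) • one = _
  simp [Fin.sum_univ_two]

omit [IsOrderedAddMonoid M] in
theorem realize_nsmulT {α : Type*} (v : α → M) (n : ℕ) (t : LOag.Term α) :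
    (nsmulT n t).realize v = n • t.realize v := by
  induction n with
  | zero => simp [nsmulT, realize_zeroT one]
  | succ n ih => rw [nsmulT, realize_addT one, ih, succ_nsmul]

-- The language has neither rational scalars nor subtraction, so denominators are cleared by `N` and
-- the result is written as a difference of terms. The sign of `f` is then a comparison of two
-- terms.
omit [IsOrderedAddMonoid M] in
theorem exists_terms_of_mem_ratAffine {β : Type*} {f : (β → M) → M} (hf : f ∈ ratAffine β M) :
    ∃ N : ℕ, 0 < N ∧ ∃ s t : LOag.Term ((Set.univ : Set M) ⊕ β), ∀ x : β → M,
      N • f x = s.realize (Sum.elim (↑) x) - t.realize (Sum.elim (↑) x) := by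
  induction hf using Submodule.span_induction with
  | mem f h =>
    refine ⟨1, one_pos, ?_⟩
    rcases h with ⟨i, rfl⟩ | ⟨c, rfl⟩
    · exact ⟨.var (.inr i), zeroT, fun x => by simp [realize_zeroT one]⟩
    · exact ⟨.var (.inl ⟨c, trivial⟩), zeroT, fun x => by simp [realize_zeroT one]⟩
  | zero => exact ⟨1, one_pos, zeroT, zeroT, fun x => by simp⟩
  | add f g _ _ hf hg =>
    obtain ⟨m, hm, s, t, h⟩ := hf
    obtain ⟨n, hn, s', t', h'⟩ := hg
    refine ⟨m * n, Nat.mul_pos hm hn, addT (nsmulT n s) (nsmulT m s'),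
      addT (nsmulT n t) (nsmulT m t'), fun x => ?_⟩
    simp only [realize_addT one, realize_nsmulT one, Pi.add_apply, smul_add]
    rw [mul_smul m n (g x), h', mul_comm, mul_smul, h, smul_sub, smul_sub]
    abel
  | smul r f _ hf =>
    obtain ⟨m, hm, s, t, h⟩ := hf
    have hr : ∀ x, (m * r.den) • (r • f x) = r.num • (m • f x) := by
      intro x
      rw [mul_smul, ← Nat.cast_smul_eq_nsmul ℚ r.den, smul_smul (r.den : ℚ), mul_comm,
        Rat.mul_den_eq_num, Int.cast_smul_eq_zsmul, smul_comm]
    obtain ⟨k, hk | hk⟩ := r.num.eq_nat_or_neg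
    · refine ⟨m * r.den, Nat.mul_pos hm r.den_pos, nsmulT k s, nsmulT k t, fun x => ?_⟩
      rw [Pi.smul_apply, hr, h, hk, realize_nsmulT one, realize_nsmulT one, natCast_zsmul, smul_sub]
    · refine ⟨m * r.den, Nat.mul_pos hm r.den_pos, nsmulT k t, nsmulT k s, fun x => ?_⟩
      rw [Pi.smul_apply, hr, h, hk, realize_nsmulT one, realize_nsmulT one, neg_smul, natCast_zsmul,
        smul_sub, neg_sub]

variable [LOag.OrderedStructure M]

theorem definable_setOf_pos {β : Type*} {f : (β → M) → M} (hf : f ∈ ratAffine β M) :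
    (Set.univ : Set M).Definable LOag {x | 0 < f x} := by
  obtain ⟨N, hN, s, t, h⟩ := exists_terms_of_mem_ratAffine one hf
  refine Set.definable_iff_exists_formula_sum.2
    ⟨Term.lt (t.relabel Sum.inl) (s.relabel Sum.inl), ?_⟩
  ext x
  rw [Set.mem_ofPred_eq, Set.mem_ofPred_eq, Formula.Realize, Term.realize_lt, Term.realize_relabel,
    Term.realize_relabel, Sum.elim_comp_inl, ← sub_pos (a := s.realize _), ← h, nsmul_pos_iff hN.ne']

theorem definable_setOf_eq_zero {β : Type*} {f : (β → M) → M} (hf : f ∈ ratAffine β M) :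
    (Set.univ : Set M).Definable LOag {x | f x = 0} := by
  have := (definable_setOf_pos one hf).compl.inter (definable_setOf_pos one (neg_mem hf)).compl
  convert this using 1
  ext x
  simp only [Set.mem_ofPred_eq, Set.mem_inter_iff, Set.mem_compl_iff, not_lt, Pi.neg_apply,
    neg_nonpos]
  exact le_antisymm_iff

end RatAffine

/-! ### Open definable sets are definable in the reduct -/

section OpenSets

theorem affine_add {K M : Type*} [Field K] [AddCommGroup M] [Module K M] {β : Type*} [Fintype β]
    (x h : β → M) (w : (β → K) × M) :
    affine (x + h) w = affine x w + ∑ i, w.1 i • h i := by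
  simp only [affine, Pi.add_apply, smul_add, Finset.sum_add_distrib]
  abel

theorem affine_mem_ratAffine {M : Type*} [AddCommGroup M] [Module ℚ M] {β : Type*} [Fintype β]
    (w : (β → ℚ) × M) :
    (fun x : β → M => affine x w) ∈ ratAffine β M :=
  add_mem (sum_smul_mem_ratAffine _ _ fun i => apply_mem_ratAffine i) (const_mem_ratAffine _)

theorem definable_setOf_holds_of_atoms {M : Type*} [AddCommGroup M] [LinearOrder M]
    [IsOrderedAddMonoid M] [Module ℚ M] {L : FirstOrder.Language.{u, v}} [L.Structure M] {n : ℕ}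
    (hpos : ∀ w : (Fin n → ℚ) × M,
      (Set.univ : Set M).Definable L {x : Fin n → M | 0 < affine x w}) (F : DNF ((Fin n → ℚ) × M)) :
    (Set.univ : Set M).Definable L {x : Fin n → M | DNF.Holds F (affine x)} := by
  have hneg : ∀ (w : (Fin n → ℚ) × M) (x : Fin n → M), affine x (-w) = -affine x w := by
    intro w x
    simp [affine, add_comm]
  have heq : ∀ w : (Fin n → ℚ) × M,
      (Set.univ : Set M).Definable L {x : Fin n → M | affine x w = 0} := by
    intro w
    convert (hpos w).compl.inter (hpos (-w)).compl using 1
    ext x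
    simp only [Set.mem_ofPred_eq, Set.mem_inter_iff, Set.mem_compl_iff, not_lt, hneg, neg_nonpos]
    exact le_antisymm_iff
  have hall : ∀ (l : List ((Fin n → ℚ) × M)) (P : (Fin n → M) → (Fin n → ℚ) × M → Prop),
      (∀ w, (Set.univ : Set M).Definable L {x | P x w}) →
        (Set.univ : Set M).Definable L {x | ∀ w ∈ l, P x w} := by
    intro l P hP
    induction l with
    | nil => simp
    | cons w l ih =>
      simp only [List.forall_mem_cons]
      exact (hP w).inter ih
  induction F with
  | nil => simp [DNF.holds_nil]
  | cons C F ih =>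
    simp only [DNF.holds_cons]
    exact ((hall _ _ heq).inter (hall _ _ hpos)).union ih


variable {M : Type w} [LOag.Structure M] [AddCommGroup M] [LinearOrder M] [IsOrderedAddMonoid M]
  [Module ℚ M] [Nontrivial M] [LOag.OrderedStructure M] (one : M) [LinearStructure LOag ℚ one]
  {K : Type*} [Field K] [CharZero K] [Module K M] [DenseScalars K M]

-- The solution set is `g '' (O ∩ D)`, with `g` rational affine, `O` open and cut out by rational
-- inequalities, and `D` the dense set of tuples `p k • y j`. Scalars outside ℚ enter only through
-- `D`, and passing to the closure erases `D`.
include one in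
theorem definable_closure_clause [TopologicalSpace M] [OrderTopology M] {n : ℕ}
    (C : List ((Fin n → K) × M) × List ((Fin n → K) × M)) :
    (Set.univ : Set M).Definable LOag (closure {x : Fin n → M | DNF.Clause C (affine x)}) := by
  classical
  -- A point of the set supplies a particular solution `x₀` of the equations; its inequalities are
  -- not needed.
  rcases Set.eq_empty_or_nonempty {x : Fin n → M | DNF.Clause C (affine x)} with h0 | ⟨x₀, hx₀, -⟩
  · rw [h0, closure_empty]; exact Set.definable_empty
  obtain ⟨d, N, hN⟩ := exists_parametrization.{w} (C.1.map Prod.fst)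
  -- Coefficients of the form `w` in the parameters `y` after substituting `x₀ + N y`. One
  -- independent tuple `p` has to serve both these and the entries of `N`.
  let B : (Fin n → K) × M → Fin d → K := fun w j => ∑ i, w.1 i * N i j
  obtain ⟨r, p, c, hp, hc⟩ := exists_rat_coordinates
    ((Finset.univ.image fun t : Fin n × Fin d => N t.1 t.2) ∪
      (C.2.toFinset ×ˢ Finset.univ).image fun t => B t.1 t.2)
  have hcN : ∀ i j, N i j = ∑ k, c (N i j) k • p k := fun i j =>
    hc _ (Finset.mem_union_left _ (Finset.mem_image_of_mem (fun t : Fin n × Fin d => N t.1 t.2)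
      (Finset.mem_univ (i, j))))
  have hcB : ∀ w ∈ C.2, ∀ j, B w j = ∑ k, c (B w j) k • p k := fun w hw j =>
    hc _ (Finset.mem_union_right _ (Finset.mem_image.2 ⟨(w, j), by simpa using hw, rfl⟩))
  let g : (Fin d × Fin r → M) → Fin n → M := fun z i =>
    x₀ i + ∑ t : Fin d × Fin r, c (N i t.1) t.2 • z t
  let f : (Fin n → K) × M → (Fin d × Fin r → M) → M := fun w z =>
    affine x₀ w + ∑ t : Fin d × Fin r, c (B w t.1) t.2 • z t
  let D : Set (Fin d × Fin r → M) := Set.range fun (y : Fin d → M) t => p t.2 • y t.1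
  let O : Set (Fin d × Fin r → M) := {z | ∀ w ∈ C.2, 0 < f w z}
  have hg : ∀ i, (fun z => g z i) ∈ ratAffine (Fin d × Fin r) M := fun i =>
    add_mem (const_mem_ratAffine _) (sum_smul_mem_ratAffine _ _ fun t => apply_mem_ratAffine t)
  have hf : ∀ w, f w ∈ ratAffine (Fin d × Fin r) M := fun i =>
    add_mem (const_mem_ratAffine _) (sum_smul_mem_ratAffine _ _ fun t => apply_mem_ratAffine t)
  have hO' : O = ⋂ w ∈ C.2.toFinset, {z | 0 < f w z} := by ext; simp [O]
  have hO : IsOpen O := by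
    rw [hO']
    exact isOpen_biInter_finset fun w _ =>
      isOpen_lt continuous_const (continuous_of_mem_ratAffine (hf w))
  -- Each `y j` governs its own block of `r` coordinates, so density is applied to the blocks
  -- separately.
  have hD : Dense D := by
    intro z
    rw [mem_closure_iff]
    intro U hU hz
    obtain ⟨a, b, h1, h2⟩ := exists_box_subset hU hz
    choose y hy using fun j => DenseScalars.dense (M := M) p hp (fun k => a (j, k))
      (fun k => b (j, k)) fun k => (h1 (j, k)).1.trans (h1 (j, k)).2
    exact ⟨_, h2 _ fun t => hy t.1 t.2, y, rfl⟩
  have hgD : ∀ y : Fin d → M, g (fun t => p t.2 • y t.1) = x₀ + fun i => ∑ j, N i j • y j := by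
    intro y
    ext i
    simp only [g, Pi.add_apply, Fintype.sum_prod_type]
    refine congrArg _ (Finset.sum_congr rfl fun j _ => ?_)
    exact (smul_eq_sum_smul (hcN i j) _).symm
  have hfD : ∀ w ∈ C.2, ∀ y : Fin d → M, f w (fun t => p t.2 • y t.1) =
      affine (x₀ + fun i => ∑ j, N i j • y j) w := by
    intro w hw y
    rw [affine_add]
    simp only [f, Fintype.sum_prod_type, Finset.smul_sum, smul_smul]
    rw [Finset.sum_comm (s := (Finset.univ : Finset (Fin n)))]
    refine congrArg _ (Finset.sum_congr rfl fun j _ => ?_)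
    rw [← Finset.sum_smul]
    exact (smul_eq_sum_smul (hcB w hw j) _).symm
  have hS : {x : Fin n → M | DNF.Clause C (affine x)} = g '' (O ∩ D) := by
    ext x
    have h1 := hN M (x - x₀)
    have h2 : (∀ w ∈ C.1, affine x w = 0) ↔ ∃ y : Fin d → M, x = x₀ + fun i => ∑ j, N i j • y j := by
      have h3 : ∀ y : Fin d → M, x = (x₀ + fun i => ∑ j, N i j • y j) ↔
          ∀ i, (x - x₀) i = ∑ j, N i j • y j := by
        intro y
        rw [← sub_eq_iff_eq_add', funext_iff]
      simp only [h3]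
      rw [← h1]
      simp only [List.mem_map, forall_exists_index, and_imp, forall_apply_eq_imp_iff₂]
      refine forall₂_congr fun w hw => ?_
      have := affine_add x₀ (x - x₀) w
      rw [add_sub_cancel, hx₀ w hw, zero_add] at this
      rw [this]
    rw [Set.mem_ofPred_eq, DNF.Clause, h2]
    constructor
    · rintro ⟨⟨y, rfl⟩, h⟩
      exact ⟨_, ⟨fun w hw => by rw [hfD w hw]; exact h w hw, y, rfl⟩, hgD y⟩
    · rintro ⟨_, ⟨h, y, rfl⟩, rfl⟩
      refine ⟨⟨y, hgD y⟩, fun w hw => ?_⟩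
      rw [hgD, ← hfD w hw]
      exact h w hw
  have hgc : Continuous g := continuous_pi fun i => continuous_of_mem_ratAffine (hg i)
  have hcl : closure {x : Fin n → M | DNF.Clause C (affine x)} = closure (g '' O) := by
    rw [hS]
    refine (closure_mono (Set.image_mono Set.inter_subset_left)).antisymm
      (closure_minimal ?_ isClosed_closure)
    -- As `D` is dense and `O` open, `O` lies in the closure of `O ∩ D`; continuity of `g`
    -- transports this to the images.
    exact (Set.image_mono (hD.open_subset_closure_inter hO)).trans
      (image_closure_subset_closure_image hgc)
  rw [hcl]
  refine definable_closure ?_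
  have himg : g '' O = {x : Fin n → M | ∃ z : Fin d × Fin r → M, Sum.elim x z ∈
      (⋂ i, {y : Fin n ⊕ (Fin d × Fin r) → M | g (fun t => y (.inr t)) i - y (.inl i) = 0}) ∩
        {y | (fun t => y (.inr t)) ∈ O}} := by
    ext x
    simp only [Set.mem_image, Set.mem_ofPred_eq, Set.mem_inter_iff, Set.mem_iInter, Sum.elim_inl,
      Sum.elim_inr, sub_eq_zero, funext_iff]
    exact exists_congr fun z => and_comm
  rw [himg]
  refine Set.Definable.exists_of_finite (.inter (Set.definable_iInter_of_finite fun i =>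
    definable_setOf_eq_zero one ?_) ?_)
  · refine sub_mem (add_mem (const_mem_ratAffine _) (sum_smul_mem_ratAffine _ _ fun t =>
      apply_mem_ratAffine (Sum.inr t))) (apply_mem_ratAffine (Sum.inl i))
  · refine Set.Definable.preimage_comp Sum.inr (s := O) ?_
    rw [hO']
    exact Set.definable_biInter_finset (fun w => definable_setOf_pos one (hf w)) _

-- The complement of `U` is closed, so it equals the union of the closures of the finitely many
-- clauses defining it.
include one in
theorem definable_of_isOpen [TopologicalSpace M] [OrderTopology M] {n : ℕ} {U : Set (Fin n → M)}
    (hU : IsOpen U) (F : DNF ((Fin n → K) × M)) (hF : Uᶜ = {x | DNF.Holds F (affine x)}) :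
    (Set.univ : Set M).Definable LOag U := by
  have h : ∀ F : DNF ((Fin n → K) × M),
      (Set.univ : Set M).Definable LOag (closure {x : Fin n → M | DNF.Holds F (affine x)}) := by
    intro F
    induction F with
    | nil =>
      simp only [DNF.holds_nil]
      simp
    | cons C F ih =>
      simp only [DNF.holds_cons]
      have : closure {x : Fin n → M | DNF.Clause C (affine x) ∨ DNF.Holds F (affine x)} =
        closure {x | DNF.Clause C (affine x)} ∪ closure {x | DNF.Holds F (affine x)} := closure_union
      rw [this]
      exact (definable_closure_clause one C).union ih
  have := h F
  rw [← hF, hU.isClosed_compl.closure_eq] at this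
  simpa using this.compl

end OpenSets

/-! ### Divisible torsion-free groups are rational vector spaces -/

section RatModule

theorem exists_ratModule {M : Type*} [AddCommGroup M] [IsAddTorsionFree M]
    (h : ∀ n : ℕ, 1 ≤ n → ∀ x : M, ∃ y, n • y = x) : Nonempty (Module ℚ M) := by
  have hcancel : ∀ (n : ℕ), n ≠ 0 → ∀ x y : M, n • x = n • y → x = y := fun n hn x y hxy =>
    nsmul_right_injective hn hxy
  choose! div hdiv using h
  let sm : ℚ → M → M := fun q x => q.num • div q.den x
  have key : ∀ (q : ℚ) (x : M) (a : ℤ) (b : ℕ), b ≠ 0 → q * b = a → b • sm q x = a • x := by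
    intro q x a b hb hab
    apply hcancel q.den q.den_ne_zero
    -- This is the defining property of `sm`. The claim `key` extends it to every fraction
    -- representing `q`, and each module axiom then follows by cancelling a common denominator.
    have h1 : q.den • sm q x = q.num • x := by
      simp only [sm]
      rw [smul_comm, hdiv _ q.den_pos]
    have h2 : (b : ℤ) * q.num = q.den * a := by
      have : ((b : ℤ) * q.num : ℚ) = q.den * a := by
        rw [← hab, ← Rat.mul_den_eq_num q]; push_cast; ring
      exact_mod_cast this
    rw [smul_comm, h1, ← natCast_zsmul, ← natCast_zsmul, smul_smul, smul_smul, h2]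
  have hden : ∀ (q : ℚ) (x : M), q.den • sm q x = q.num • x := fun q x =>
    key q x q.num q.den q.den_ne_zero (Rat.mul_den_eq_num q)
  have h_one : ∀ x, sm 1 x = x := by
    intro x
    simpa using key 1 x 1 1 one_ne_zero (by simp)
  have h_mul : ∀ q r x, sm (q * r) x = sm q (sm r x) := by
    intro q r x
    apply hcancel (q.den * r.den) (mul_ne_zero q.den_ne_zero r.den_ne_zero)
    refine (key (q * r) x (q.num * r.num) _ (mul_ne_zero q.den_ne_zero r.den_ne_zero) ?_).trans ?_
    · push_cast
      rw [← Rat.mul_den_eq_num q, ← Rat.mul_den_eq_num r]; ring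
    · rw [mul_comm q.den, mul_smul (r.den), hden, smul_comm, hden, smul_smul]
  have h_szero : ∀ q, sm q 0 = 0 := by
    intro q
    apply hcancel q.den q.den_ne_zero
    exact (hden q 0).trans (by simp)
  have h_add : ∀ q x y, sm q (x + y) = sm q x + sm q y := by
    intro q x y
    apply hcancel q.den q.den_ne_zero
    refine (hden q _).trans ?_
    rw [smul_add, smul_add, hden, hden]
  have h_sadd : ∀ q r x, sm (q + r) x = sm q x + sm r x := by
    intro q r x
    apply hcancel (q.den * r.den) (mul_ne_zero q.den_ne_zero r.den_ne_zero)
    refine (key (q + r) x (r.den * q.num + q.den * r.num) _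
      (mul_ne_zero q.den_ne_zero r.den_ne_zero) ?_).trans ?_
    · push_cast
      rw [← Rat.mul_den_eq_num q, ← Rat.mul_den_eq_num r]; ring
    · rw [smul_add, mul_smul q.den r.den (sm r x), hden, mul_comm q.den, mul_smul, hden, add_smul,
        mul_smul, mul_smul, natCast_zsmul, natCast_zsmul]
  have h_zero : ∀ x, sm 0 x = 0 := by
    intro x
    simpa using key 0 x 0 1 one_ne_zero (by simp)
  exact ⟨{ smul := sm, one_smul := h_one, mul_smul := h_mul, smul_zero := h_szero, smul_add := h_add,
            add_smul := h_sadd, zero_smul := h_zero }⟩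

end RatModule

/-! ### From models of the axioms to ordered vector spaces -/

section Models

theorem exists_linearStructure_of_models_ODAG (M : Type w) [LOag.Structure M] (h : M ⊨ ODAG) :
    ∃ (_ : AddCommGroup M) (_ : LinearOrder M) (_ : IsOrderedAddMonoid M) (_ : Module ℚ M)
      (_ : Nontrivial M) (one : M),
      0 < one ∧ LOag.OrderedStructure M ∧ LinearStructure LOag ℚ one := by
  classical
  have hlin : M ⊨ LOag.linearOrderTheory :=
    h.mono (Set.subset_union_left.trans Set.subset_union_left)
  let _ : LinearOrder M := LOag.linearOrderOfModels M
  have hord : LOag.OrderedStructure M := inferInstance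
  let add : M → M → M := fun a b => Structure.funMap (L := LOag) (Sum.inl presburgerFunc.add) ![a, b]
  let zero : M := Structure.funMap (L := LOag) (Sum.inl presburgerFunc.zero) ![]
  let one : M := Structure.funMap (L := LOag) (Sum.inl presburgerFunc.one) ![]
  have hadd : ∀ {α : Type} (v : α → M) (s t : LOag.Term α),
      (addT s t).realize v = add (s.realize v) (t.realize v) := fun v s t =>
    Term.realize_functions_apply₂
  have hzero : ∀ {α : Type} (v : α → M), (zeroT : LOag.Term α).realize v = zero := fun v =>
    congrArg (Structure.funMap (L := LOag) _) (Subsingleton.elim _ _)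
  have hone : ∀ {α : Type} (v : α → M), (oneT : LOag.Term α).realize v = one := fun v =>
    congrArg (Structure.funMap (L := LOag) _) (Subsingleton.elim _ _)
  have hax : ∀ φ ∈ oagAxioms, M ⊨ φ := fun φ hφ => h.realize_of_mem φ (Or.inl hφ)
  have h1 := hax _ (Or.inr (Or.inl rfl))
  have h2 := hax _ (Or.inr (Or.inr (Or.inl rfl)))
  have h3 := hax _ (Or.inr (Or.inr (Or.inr (Or.inl rfl))))
  have h4 := hax _ (Or.inr (Or.inr (Or.inr (Or.inr (Or.inl rfl)))))
  have h5 := hax _ (Or.inr (Or.inr (Or.inr (Or.inr (Or.inr (Or.inl rfl))))))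
  have h6 := hax _ (Or.inr (Or.inr (Or.inr (Or.inr (Or.inr (Or.inr rfl))))))
  simp only [Sentence.Realize, Formula.Realize, BoundedFormula.realize_all,
    BoundedFormula.realize_ex, BoundedFormula.realize_bdEqual, BoundedFormula.realize_imp,
    Term.realize_lt, hadd, hzero, hone] at h1 h2 h3 h4 h5 h6
  simp [Fin.snoc] at h1 h2 h3 h4 h5
  choose neg hneg using h4
  let _ : Add M := ⟨add⟩
  let _ : Zero M := ⟨zero⟩
  let _ : Neg M := ⟨neg⟩
  let _ : AddCommGroup M :=
    { nsmul := nsmulRec, zsmul := zsmulRec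
      add_assoc := h1
      zero_add := fun a => (h2 zero a).trans (h3 a)
      add_zero := h3
      neg_add_cancel := fun a => (h2 (neg a) a).trans (hneg a)
      add_comm := h2 }
  have hmono : IsOrderedAddMonoid M :=
    { add_le_add_left := fun a b hab c => by
        rcases hab.lt_or_eq with hab | rfl
        · exact (h5 a b c hab).le
        · exact le_rfl }
  have hnsmul : ∀ {α : Type} (v : α → M) (n : ℕ) (t : LOag.Term α),
      (nsmulT n t).realize v = n • t.realize v := by
    intro α v n t
    induction n with
    | zero => rw [zero_smul]; exact hzero v
    | succ n ih => rw [nsmulT, hadd, ih, succ_nsmul]; rfl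
  obtain ⟨hmod⟩ := exists_ratModule (M := M) fun n hn x => by
    have := h.realize_of_mem (divisibleBy n) (Or.inr ⟨n, hn, rfl⟩)
    simp only [divisibleBy, Sentence.Realize, Formula.Realize, BoundedFormula.realize_all,
      BoundedFormula.realize_ex, BoundedFormula.realize_bdEqual, hnsmul] at this
    obtain ⟨y, hy⟩ := this x
    exact ⟨y, hy⟩
  refine ⟨_, _, hmono, hmod, ⟨⟨0, one, h6.ne⟩⟩, one, h6, hord, ⟨?_, ?_⟩⟩
  · rintro n (f | f) x
    · cases f with
      | zero =>
        change _ = ∑ i : Fin 0, (1 : ℚ) • x i + (0 : ℚ) • one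
        rw [zero_smul, add_zero]
        exact congrArg (Structure.funMap (L := LOag) _) (Subsingleton.elim _ _)
      | one =>
        change _ = ∑ i : Fin 0, (1 : ℚ) • x i + (1 : ℚ) • one
        rw [one_smul, Finset.univ_eq_empty, Finset.sum_empty, zero_add]
        exact congrArg (Structure.funMap (L := LOag) _) (Subsingleton.elim _ _)
      | add =>
        change _ = ∑ i : Fin 2, (1 : ℚ) • x i + (0 : ℚ) • one
        rw [zero_smul, add_zero, Fin.sum_univ_two, one_smul, one_smul]
        exact congrArg (Structure.funMap (L := LOag) _) (List.ofFn_inj.1 rfl)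
    · exact f.elim
  · rintro n (R | R) x
    · exact R.elim
    · cases R
      exact hord.relMap_leSymb x

theorem exists_linearStructure_of_models_Tt (M : Type w) [LQt.Structure M] (h : M ⊨ Tt) :
    letI := reduct M
    ∃ (_ : AddCommGroup M) (_ : LinearOrder M) (_ : IsOrderedAddMonoid M) (_ : Module ℚ M)
      (_ : Nontrivial M) (_ : Module (RatFunc ℚ) M) (one : M),
      0 < one ∧ DenseScalars (RatFunc ℚ) M ∧ LOag.OrderedStructure M ∧
        LinearStructure LOag ℚ one ∧ LQt.OrderedStructure M ∧
          LinearStructure LQt (RatFunc ℚ) one := by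
  let _ := reduct M
  have hO : M ⊨ ODAG :=
    (LHom.onTheory_model incl ODAG).1 (h.mono (Set.subset_union_left.trans Set.subset_union_left))
  obtain ⟨i1, i2, i3, i4, i5, one, hone, hord, hlin⟩ := exists_linearStructure_of_models_ODAG M hO
  have hordt : LQt.OrderedStructure M := ⟨fun x => hord.relMap_leSymb x⟩
  let sm : RatFunc ℚ → M → M := fun q x =>
    Structure.funMap (L := LQt) (Sum.inr (ScalarFunc.lam q)) ![x]
  have hlam : ∀ {α : Type} (v : α → M) (q : RatFunc ℚ) (t : LQt.Term α),
      (lamT q t).realize v = sm q (t.realize v) := fun v q t =>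
    Term.realize_functions_apply₁
  have haddT : ∀ {α : Type} (v : α → M) (s t : LQt.Term α),
      (addTt s t).realize v = s.realize v + t.realize v := by
    intro α v s t
    refine Term.realize_functions_apply₂.trans ((LinearStructure.funMap_eq (L := LOag) (K := ℚ)
      (one := one) (Sum.inl presburgerFunc.add : LOag.Functions 2)
        ![s.realize v, t.realize v]).trans ?_)
    change ∑ i : Fin 2, (1 : ℚ) • ![s.realize v, t.realize v] i + (0 : ℚ) • one = _
    simp [Fin.sum_univ_two]
  have hvs : ∀ φ ∈ vectorSpaceAxioms, M ⊨ φ := fun φ hφ => h.realize_of_mem φ (Or.inl (Or.inr hφ))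
  have h1 : ∀ q x y, sm q (x + y) = sm q x + sm q y := by
    intro q x y
    have := hvs _ (Or.inl (Or.inl (Or.inl ⟨q, rfl⟩)))
    simp only [Sentence.Realize, Formula.Realize, BoundedFormula.realize_all,
      BoundedFormula.realize_bdEqual, hlam, haddT] at this
    exact this x y
  have h2 : ∀ q r x, sm (q + r) x = sm q x + sm r x := by
    intro q r x
    have := hvs _ (Or.inl (Or.inl (Or.inr ⟨q, r, rfl⟩)))
    simp only [Sentence.Realize, Formula.Realize, BoundedFormula.realize_all,
      BoundedFormula.realize_bdEqual, hlam, haddT] at this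
    exact this x
  have h3 : ∀ q r x, sm (q * r) x = sm q (sm r x) := by
    intro q r x
    have := hvs _ (Or.inl (Or.inr ⟨q, r, rfl⟩))
    simp only [Sentence.Realize, Formula.Realize, BoundedFormula.realize_all,
      BoundedFormula.realize_bdEqual, hlam] at this
    exact this x
  have h4 : ∀ x, sm 1 x = x := by
    intro x
    have := hvs _ (Or.inr rfl)
    simp only [Sentence.Realize, Formula.Realize, BoundedFormula.realize_all,
      BoundedFormula.realize_bdEqual, hlam] at this
    exact this x
  let _ : Module (RatFunc ℚ) M :=
    { smul := sm, one_smul := h4, mul_smul := h3, smul_add := h1, add_smul := h2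
      smul_zero := fun q => by
        have := h1 q 0 0
        rwa [add_zero, left_eq_add] at this
      zero_smul := fun x => by
        have := h2 0 0 x
        rwa [add_zero, left_eq_add] at this }
  refine ⟨_, _, i3, i4, i5, inferInstance, one, hone, ⟨?_⟩, hord, hlin, hordt, ⟨?_, ?_⟩⟩
  · intro m q hq a b hab
    have := BoundedFormula.realize_alls.1 (h.realize_of_mem _ (Or.inr ⟨m, q, hq, rfl⟩))
    simp only [Function.comp_apply, BoundedFormula.realize_imp, BoundedFormula.realize_iInf,
      BoundedFormula.realize_ex,
      BoundedFormula.realize_inf, Term.realize_lt, hlam, Term.realize_var, Sum.elim_inr,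
      Fin.snoc_castSucc, Fin.snoc_last] at this
    obtain ⟨x, hx⟩ := this (Fin.append a b) fun i => by
      rw [Fin.append_left, Fin.append_right]; exact hab i
    refine ⟨x, fun i => ?_⟩
    have := hx i
    rw [Fin.append_left, Fin.append_right] at this
    exact this
  · rintro n (f | f) x
    · refine (LinearStructure.funMap_eq (L := LOag) (K := ℚ) (one := one) f x).trans ?_
      rcases f with f | f
      · cases f with
        | zero =>
          change ∑ i : Fin 0, (1 : ℚ) • x i + (0 : ℚ) • one =
            ∑ i : Fin 0, (1 : RatFunc ℚ) • x i + (0 : RatFunc ℚ) • one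
          simp
        | one =>
          change ∑ i : Fin 0, (1 : ℚ) • x i + (1 : ℚ) • one =
            ∑ i : Fin 0, (1 : RatFunc ℚ) • x i + (1 : RatFunc ℚ) • one
          simp
        | add =>
          change ∑ i : Fin 2, (1 : ℚ) • x i + (0 : ℚ) • one =
            ∑ i : Fin 2, (1 : RatFunc ℚ) • x i + (0 : RatFunc ℚ) • one
          simp
      · exact f.elim
    · obtain ⟨q⟩ := f
      change _ = ∑ i : Fin 1, q • x i + (0 : RatFunc ℚ) • one
      rw [zero_smul, add_zero, Fin.sum_univ_one]
      exact congrArg (Structure.funMap (L := LQt) _) (List.ofFn_inj.1 rfl)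
  · rintro n (R | R) x
    · exact LinearStructure.relMap_iff (L := LOag) (K := ℚ) (one := one) R x
    · exact R.elim

end Models

/-! ### The order topology and dense linear orders -/

section OrderTopology

variable {L : FirstOrder.Language.{u, v}} [L.IsOrdered] {M : Type*} [L.Structure M]
  [LinearOrder M] [L.OrderedStructure M] [TopologicalSpace M] [OrderTopology M]

theorem isOpenIn_iff {n : ℕ} {U : Set (Fin n → M)} : IsOpenIn L U ↔ IsOpen U := by
  have h : ‹TopologicalSpace M› = orderTop L M := by
    rw [orderTop_eq, OrderTopology.topology_eq_generate_intervals (α := M)]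
  subst h
  rfl

theorem isDenseIn_iff {n : ℕ} {U : Set (Fin n → M)} : IsDenseIn L U ↔ Dense U := by
  have h : ‹TopologicalSpace M› = orderTop L M := by
    rw [orderTop_eq, OrderTopology.topology_eq_generate_intervals (α := M)]
  subst h
  rfl

end OrderTopology

section DLO

theorem models_dlo {L : FirstOrder.Language.{u, v}} [L.IsOrdered] (M : Type*) [L.Structure M]
    [LinearOrder M] [L.OrderedStructure M] [AddCommGroup M] [IsOrderedAddMonoid M] [Module ℚ M]
    [Nontrivial M] : M ⊨ L.dlo := by
  have := denselyOrdered_of_ratModule M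
  infer_instance

theorem extendsDLO_ODAG : ExtendsDLO ODAG := by
  intro φ hφ
  rw [Theory.models_sentence_iff]
  intro M
  obtain ⟨_, _, _, _, _, one, -, _, -⟩ := exists_linearStructure_of_models_ODAG M M.is_model
  exact (models_dlo (L := LOag) M).realize_of_mem φ hφ

theorem extendsDLO_Tt : ExtendsDLO Tt := by
  intro φ hφ
  rw [Theory.models_sentence_iff]
  intro M
  obtain ⟨_, _, _, _, _, _, one, -, -, -, -, _, -⟩ :=
    exists_linearStructure_of_models_Tt M M.is_model
  exact (models_dlo (L := LQt) M).realize_of_mem φ hφ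

end DLO

/-! ### Completeness -/

section Complete

/-- With no variables left, every form is a rational multiple of a positive element, so its sign is
that of the rational. The right-hand side does not mention `M`. -/
theorem realize_sentence_iff_holds_rat (M : Type) [LOag.Structure M] (hM : M ⊨ ODAG)
    (φ : LOag.Sentence) :
    M ⊨ φ ↔ (qfForm (K := ℚ) φ).Holds (fun w : Form ℚ Empty 0 => w.1.2) := by
  obtain ⟨_, _, _, _, _, one, hone, _, _⟩ := exists_linearStructure_of_models_ODAG M hM
  rw [Sentence.Realize, Formula.Realize, realize_iff_holds_qfForm (K := ℚ) one]
  have he : ∀ w : Form ℚ Empty 0,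
      Form.eval one (default : Empty → M) (default : Fin 0 → M) w = w.1.2 • one := by
    intro w
    rw [Form.eval_apply, Subsingleton.elim w.1.1 0]
    simp
  refine exists_congr fun C => and_congr_right fun _ => and_congr ?_ ?_
  · refine forall₂_congr fun w _ => ?_
    rw [he, smul_eq_zero_iff_left hone.ne']
  · refine forall₂_congr fun w _ => ?_
    rw [he]
    refine ⟨fun h => ?_, fun h => rat_smul_pos h hone⟩
    by_contra hw
    rcases (not_lt.1 hw).lt_or_eq with hw | hw
    · have := rat_smul_pos (neg_pos.2 hw) hone
      rw [neg_smul, neg_pos] at this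
      exact lt_asymm h this
    · rw [show w.1.2 = 0 from hw, zero_smul] at h
      exact lt_irrefl _ h

theorem isComplete_ODAG (h : ODAG.IsSatisfiable) : ODAG.IsComplete := by
  refine ⟨h, fun φ => ?_⟩
  simp only [Theory.models_sentence_iff]
  by_cases hφ : (qfForm (K := ℚ) φ).Holds (fun w : Form ℚ Empty 0 => w.1.2)
  · exact Or.inl fun M => (realize_sentence_iff_holds_rat M M.is_model φ).2 hφ
  · refine Or.inr fun M => ?_
    rw [Sentence.realize_not]
    exact fun h => hφ ((realize_sentence_iff_holds_rat M M.is_model φ).1 h)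

end Complete

/-! ### Definability in the open core -/

section OpenCoreLanguage

variable {L : FirstOrder.Language.{u, v}} [L.IsOrdered] {M : Type w} [L.Structure M]

theorem exists_realize_coreLang_term {γ : Type*} (t : (coreLang L M).Term γ) :
    ∃ s : γ, ∀ v : γ → M, t.realize v = v s := by
  cases t with
  | var s => exact ⟨s, fun v => rfl⟩
  | func f ts => exact f.elim

/-- Induction on formulas: each relation symbol is replaced by a defining formula, whose parameters
become extra free variables. Without function symbols, every term is a variable. -/
theorem exists_formula_of_coreLang_formula {L' : FirstOrder.Language.{u', v'}} [L'.Structure M]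
    (h : ∀ (n : ℕ) (U : Set (Fin n → M)), IsOpenIn L U → DefinableIn L U → DefinableIn L' U)
    {γ : Type w} {k : ℕ} (φ : (coreLang L M).BoundedFormula γ k) :
    ∃ ψ : L'.BoundedFormula ((Set.univ : Set M) ⊕ γ) k, ∀ (v : γ → M) (xs : Fin k → M),
      φ.Realize v xs ↔ ψ.Realize (Sum.elim (↑) v) xs := by
  have hι : ∀ {k : ℕ} (v : γ → M) (xs : Fin k → M) (s : γ ⊕ Fin k),
      Sum.elim (Sum.elim (fun a : (Set.univ : Set M) => (a : M)) v) xs (Sum.map Sum.inr id s) =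
        Sum.elim v xs s := by
    rintro k v xs (s | s) <;> rfl
  induction φ with
  | falsum => exact ⟨.falsum, fun _ _ => Iff.rfl⟩
  | equal t₁ t₂ =>
    obtain ⟨s₁, h₁⟩ := exists_realize_coreLang_term t₁
    obtain ⟨s₂, h₂⟩ := exists_realize_coreLang_term t₂
    refine ⟨.equal (.var (Sum.map Sum.inr id s₁)) (.var (Sum.map Sum.inr id s₂)), fun v xs => ?_⟩
    simp only [BoundedFormula.Realize, h₁, h₂, Term.realize_var, hι]
  | rel R ts =>
    choose s hs using fun i => exists_realize_coreLang_term (ts i)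
    obtain ⟨ψ, hψ⟩ := Set.definable_iff_exists_formula_sum.1 (h _ R.1 R.2.1 R.2.2)
    refine ⟨BoundedFormula.relabel
      (Sum.elim (fun a => Sum.inl (Sum.inl a)) fun i => Sum.map Sum.inr id (s i)) ψ,
      fun v xs => ?_⟩
    rw [BoundedFormula.realize_relabel]
    have h1 : (BoundedFormula.rel R ts).Realize v xs ↔ (fun i => Sum.elim v xs (s i)) ∈ R.1 := by
      simp only [BoundedFormula.Realize, hs]
      rfl
    rw [h1, hψ, Set.mem_ofPred_eq, Formula.Realize]
    have h2 : (Sum.elim (fun a : (Set.univ : Set M) => (a : M)) fun i => Sum.elim v xs (s i)) =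
        Sum.elim (Sum.elim (fun a : (Set.univ : Set M) => (a : M)) v) (xs ∘ Fin.castAdd 0) ∘
          Sum.elim (fun a => Sum.inl (Sum.inl a)) fun i => Sum.map Sum.inr id (s i) := by
      ext (a | i)
      · rfl
      · exact (hι v xs (s i)).symm
    rw [h2]
    exact iff_of_eq (congrArg _ (Subsingleton.elim _ _))
  | imp φ₁ φ₂ h₁ h₂ =>
    obtain ⟨ψ₁, h₁⟩ := h₁
    obtain ⟨ψ₂, h₂⟩ := h₂
    exact ⟨ψ₁.imp ψ₂, fun v xs => by simp only [BoundedFormula.realize_imp, h₁, h₂]⟩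
  | all φ h₁ =>
    obtain ⟨ψ, h₁⟩ := h₁
    exact ⟨ψ.all, fun v xs => by simp only [BoundedFormula.realize_all, h₁]⟩

theorem definableIn_of_coreLang {L' : FirstOrder.Language.{u', v'}} [L'.Structure M]
    (h : ∀ (n : ℕ) (U : Set (Fin n → M)), IsOpenIn L U → DefinableIn L U → DefinableIn L' U)
    {n : ℕ} {S : Set (Fin n → M)} (hS : DefinableIn (coreLang L M) S) : DefinableIn L' S := by
  obtain ⟨φ, rfl⟩ := Set.definable_iff_exists_formula_sum.1 hS
  obtain ⟨ψ, hψ⟩ := exists_formula_of_coreLang_formula h φ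
  refine Set.definable_iff_exists_formula_sum.2 ⟨Formula.relabel (Sum.elim Sum.inl id) ψ, ?_⟩
  ext v
  rw [Set.mem_ofPred_eq, Set.mem_ofPred_eq, Formula.realize_relabel]
  refine (hψ _ _).trans (iff_of_eq (congrArg (fun e => BoundedFormula.Realize ψ e default) ?_))
  ext (a | a | i) <;> rfl

theorem definableIn_coreLang {n : ℕ} {U : Set (Fin n → M)} (hU : IsOpenIn L U)
    (hU' : DefinableIn L U) : DefinableIn (coreLang L M) U := by
  let R : (coreLang L M).Relations n := ⟨U, hU, hU'⟩
  refine Set.definable_iff_exists_formula_sum.2 ⟨R.formula fun i => .var (Sum.inr i), ?_⟩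
  ext v
  rw [Set.mem_ofPred_eq, Formula.realize_rel]
  rfl

end OpenCoreLanguage

/-! ### Spans lie in the definable closure -/

section Exchange

variable {M : Type w} [LQt.Structure M] [AddCommGroup M] [LinearOrder M] [Module (RatFunc ℚ) M]
  (one : M) [LinearStructure LQt (RatFunc ℚ) one]

include one in
theorem realize_lamT {α : Type*} (v : α → M) (q : RatFunc ℚ) (t : LQt.Term α) :
    (lamT q t).realize v = q • t.realize v := by
  refine Term.realize_functions_apply₁.trans ((LinearStructure.funMap_eq (L := LQt)
    (K := RatFunc ℚ) (one := one) (Sum.inr (ScalarFunc.lam q) : LQt.Functions 1) _).trans ?_)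
  change ∑ i : Fin 1, q • ![t.realize v] i + (0 : RatFunc ℚ) • one = _
  simp

include one in
theorem realize_addTt {α : Type*} (v : α → M) (s t : LQt.Term α) :
    (addTt s t).realize v = s.realize v + t.realize v := by
  refine Term.realize_functions_apply₂.trans ((LinearStructure.funMap_eq (L := LQt)
    (K := RatFunc ℚ) (one := one)
    (Sum.inl (Sum.inl presburgerFunc.add) : LQt.Functions 2) _).trans ?_)
  change ∑ i : Fin 2, (1 : RatFunc ℚ) • ![s.realize v, t.realize v] i + (0 : RatFunc ℚ) • one = _
  simp [Fin.sum_univ_two]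

theorem span_subset_dcl (A : Set M) :
    (Submodule.span (RatFunc ℚ) (insert one A) : Set M) ⊆ dcl LQt A := by
  have hterm : ∀ b ∈ Submodule.span (RatFunc ℚ) (insert one A),
      ∃ t : LQt.Term A, t.realize (↑) = b := by
    intro b hb
    have h1 : (Constants.term (Sum.inl (Sum.inl presburgerFunc.one) : LQt.Functions 0) :
        LQt.Term A).realize (fun a : A => (a : M)) = one := by
      refine (LinearStructure.funMap_eq (L := LQt) (K := RatFunc ℚ) (one := one)
        (Sum.inl (Sum.inl presburgerFunc.one) : LQt.Functions 0) _).trans ?_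
      change ∑ i : Fin 0, (1 : RatFunc ℚ) • _ + (1 : RatFunc ℚ) • one = _
      simp
    induction hb using Submodule.span_induction with
    | mem b hb =>
      rcases hb with rfl | hb
      · exact ⟨_, h1⟩
      · exact ⟨.var ⟨b, hb⟩, rfl⟩
    | zero => exact ⟨lamT 0 (Constants.term (Sum.inl (Sum.inl presburgerFunc.one) : LQt.Functions 0)),
      (realize_lamT one _ _ _).trans (zero_smul _ _)⟩
    | add x y _ _ hx hy =>
      obtain ⟨s, rfl⟩ := hx
      obtain ⟨t, rfl⟩ := hy
      exact ⟨addTt s t, realize_addTt one _ _ _⟩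
    | smul q x _ hx =>
      obtain ⟨t, rfl⟩ := hx
      exact ⟨lamT q t, realize_lamT one _ _ _⟩
  intro b hb
  obtain ⟨t, rfl⟩ := hterm b hb
  refine Set.definable_iff_exists_formula_sum.2
    ⟨Term.equal (.var (Sum.inr 0)) (t.relabel Sum.inl), ?_⟩
  ext v
  rw [Set.mem_ofPred_eq, Set.mem_ofPred_eq, Formula.realize_equal, Term.realize_relabel]
  rfl

end Exchange

/-! ### Open core, dense graph and exchange in models of `Tt` -/

section ModelsOfTt

variable {M : Type w} [LQt.Structure M]

theorem definableIn_reduct_of_isOpenIn (hM : M ⊨ Tt) {n : ℕ} {U : Set (Fin n → M)}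
    (hU : IsOpenIn LQt U) (hU' : DefinableIn LQt U) : @DefinableIn LOag M (reduct M) n U := by
  let _ := reduct M
  obtain ⟨_, _, _, _, _, _, one, -, _, _, _, _, _⟩ := exists_linearStructure_of_models_Tt M hM
  let _ : TopologicalSpace M := Preorder.topology M
  have : OrderTopology M := ⟨rfl⟩
  obtain ⟨F, -, hF⟩ := exists_dnf_of_definable (K := RatFunc ℚ) one hU'.compl
  exact definable_of_isOpen (K := RatFunc ℚ) one (isOpenIn_iff.1 hU) F hF

theorem interdefinable_coreLang_reduct (hM : M ⊨ Tt) :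
    @Interdefinable (coreLang LQt M) LOag M _ (reduct M) := by
  let _ := reduct M
  have hexp : incl.IsExpansionOn M := LHom.isExpansionOn_reduct incl M
  obtain ⟨_, _, _, _, _, _, one, -, _, _, _, _, _⟩ := exists_linearStructure_of_models_Tt M hM
  let _ : TopologicalSpace M := Preorder.topology M
  have : OrderTopology M := ⟨rfl⟩
  refine fun n S => ⟨fun hS => definableIn_of_coreLang
    (fun n U h1 h2 => definableIn_reduct_of_isOpenIn hM h1 h2) hS, fun hS => ?_⟩
  obtain ⟨F, -, rfl⟩ := exists_dnf_of_definable (K := ℚ) one hS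
  -- Positivity sets of rational affine functions are open, hence atoms of the open core; an
  -- equation is the complement of two of them.
  refine definable_setOf_holds_of_atoms (fun w => definableIn_coreLang ?_ ?_) F
  · exact isOpenIn_iff.2 (isOpen_lt continuous_const
      (continuous_of_mem_ratAffine (affine_mem_ratAffine w)))
  · exact (definable_setOf_pos one (affine_mem_ratAffine w)).map_expansion incl

theorem linearIndependent_one_X : LinearIndependent ℚ ![(1 : RatFunc ℚ), RatFunc.X] := by
  rw [LinearIndependent.pair_iff]
  intro s t h
  have hC : ∀ r : ℚ, algebraMap (Polynomial ℚ) (RatFunc ℚ) (Polynomial.C r) = r := fun r =>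
    eq_ratCast ((algebraMap (Polynomial ℚ) (RatFunc ℚ)).comp Polynomial.C) r
  have h1 : algebraMap (Polynomial ℚ) (RatFunc ℚ)
      (Polynomial.C s + Polynomial.C t * Polynomial.X) = 0 := by
    rw [← h, map_add, map_mul, RatFunc.algebraMap_X, Rat.smul_def, Rat.smul_def, mul_one, hC, hC]
  have h2 := (IsFractionRing.injective (Polynomial ℚ) (RatFunc ℚ)) (h1.trans (map_zero _).symm)
  have h3 := congrArg (Polynomial.coeff · 0) h2
  have h4 := congrArg (Polynomial.coeff · 1) h2
  simp at h3 h4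
  exact ⟨h3, h4⟩

theorem exists_definable_function_dense_graph (hM : M ⊨ Tt) :
    ∃ f : M → M, DefinableIn LQt {x : Fin 2 → M | x 1 = f (x 0)} ∧
      IsDenseIn LQt {x : Fin 2 → M | x 1 = f (x 0)} := by
  let _ := reduct M
  obtain ⟨_, _, _, _, _, _, one, -, _, _, _, _, _⟩ := exists_linearStructure_of_models_Tt M hM
  let _ : TopologicalSpace M := Preorder.topology M
  have : OrderTopology M := ⟨rfl⟩
  refine ⟨fun x => (RatFunc.X : RatFunc ℚ) • x, ?_, isDenseIn_iff.2 ?_⟩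
  · refine Set.definable_iff_exists_formula_sum.2
      ⟨Term.equal (.var (Sum.inr 1)) (lamT RatFunc.X (.var (Sum.inr 0))), ?_⟩
    ext v
    rw [Set.mem_ofPred_eq, Set.mem_ofPred_eq, Formula.realize_equal]
    rw [realize_lamT one]
    rfl
  · intro z
    rw [mem_closure_iff]
    intro U hU hz
    obtain ⟨a, b, hab, hsub⟩ := exists_box_subset hU hz
    obtain ⟨x, hx⟩ := DenseScalars.dense (M := M) _ linearIndependent_one_X a b
      fun i => (hab i).1.trans (hab i).2
    refine ⟨fun i => ![(1 : RatFunc ℚ), RatFunc.X] i • x, hsub _ hx, ?_⟩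
    simp

end ModelsOfTt

theorem hasEP_of_models_Tt {M : Type w} [LQt.Structure M] (hM : M ⊨ Tt) : HasEP LQt M := by
  obtain ⟨_, _, _, _, _, _, one, -, _, _, _, _, _⟩ := exists_linearStructure_of_models_Tt M hM
  have hdcl : ∀ A : Set M, dcl LQt A = Submodule.span (RatFunc ℚ) (insert one A) := fun A =>
    (dcl_subset_span one A).antisymm (span_subset_dcl one A)
  intro S a b
  simp only [hdcl, Set.mem_sdiff, SetLike.mem_coe, Set.union_singleton,
    Set.insert_comm one]
  exact fun h => mem_span_insert_exchange h.1 h.2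

/-! ### Construction of a model -/

section Existence

theorem countable_ratFunc : Countable (RatFunc ℚ) := by
  have : Countable (Polynomial ℚ) := by
    rw [← Cardinal.mk_le_aleph0_iff]
    exact Polynomial.cardinalMk_le_max.trans (max_le Cardinal.mk_le_aleph0 le_rfl)
  have h : Function.Surjective fun p : Polynomial ℚ × Polynomial ℚ =>
      algebraMap (Polynomial ℚ) (RatFunc ℚ) p.1 / algebraMap (Polynomial ℚ) (RatFunc ℚ) p.2 := by
    intro x
    obtain ⟨a, b, -, h⟩ := IsFractionRing.div_surjective (A := Polynomial ℚ) x
    exact ⟨(a, b), h⟩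
  exact h.countable

theorem exists_linearIndependent_real (J : Type) [Countable J] :
    ∃ r : J → ℝ, LinearIndependent ℚ r := by
  have b := Module.Basis.ofVectorSpace ℚ ℝ
  have hJ : Cardinal.mk J ≤ Cardinal.mk (Module.Basis.ofVectorSpaceIndex ℚ ℝ) := by
    rw [b.mk_eq_rank'', Real.rank_rat_real]
    exact Cardinal.mk_le_aleph0.trans Cardinal.aleph0_le_continuum
  obtain ⟨f⟩ := hJ
  exact ⟨b ∘ f, b.linearIndependent.comp f f.injective⟩

/-- A linearly independent tuple of scalars with a box of rational intervals. -/
def Requirement (K : Type) [Field K] [CharZero K] : Type :=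
  Σ m : ℕ, {q : Fin m → K // LinearIndependent ℚ q} × {s : Fin m → ℚ × ℚ // ∀ i, (s i).1 < (s i).2}

/-- The factor has to be nonzero for the rescaled reals to remain ℚ-independent. -/
theorem exists_rat_mul_mem_Ioo {c d r : ℝ} (h : c < d) (hr : r ≠ 0) :
    ∃ s : ℚ, s ≠ 0 ∧ c < s * r ∧ s * r < d := by
  have hpos : ∀ {c d r : ℝ}, c < d → 0 < r → (0 ≤ c ∨ d ≤ 0) →
      ∃ s : ℚ, s ≠ 0 ∧ c < s * r ∧ s * r < d := by
    intro c d r h hr h0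
    obtain ⟨s, h1, h2⟩ := exists_rat_btwn (div_lt_div_of_pos_right h hr)
    rw [div_lt_iff₀ hr] at h1
    rw [lt_div_iff₀ hr] at h2
    refine ⟨s, ?_, h1, h2⟩
    rintro rfl
    simp only [Rat.cast_zero, zero_mul] at h1 h2
    rcases h0 with h0 | h0 <;> linarith
  have hpos' : ∀ {c d r : ℝ}, c < d → 0 < r → ∃ s : ℚ, s ≠ 0 ∧ c < s * r ∧ s * r < d := by
    intro c d r h hr
    rcases lt_or_ge 0 d with hd | hd
    -- Shrinking the interval to its positive part keeps 0 out of it, so that `s ≠ 0` is automatic.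
    · obtain ⟨s, h0, h1, h2⟩ := hpos (max_lt h hd) hr (Or.inl (le_max_right c 0))
      exact ⟨s, h0, (le_max_left c 0).trans_lt h1, h2⟩
    · exact hpos h hr (Or.inr hd)
  rcases hr.lt_or_gt with hr | hr
  · obtain ⟨s, h0, h1, h2⟩ := hpos' h (neg_pos.2 hr)
    exact ⟨-s, neg_ne_zero.2 h0, by push_cast; linarith, by push_cast; linarith⟩
  · exact hpos' h hr

theorem exists_basis_extending {K : Type} [Field K] [CharZero K] {m : ℕ} {q : Fin m → K}
    (hq : LinearIndependent ℚ q) :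
    ∃ (E : Set K) (b : Module.Basis E ℚ K), ∀ k, ∃ e : E, (e : K) = q k ∧ b e = q k := by
  have h := hq.linearIndepOn_id
  refine ⟨_, Module.Basis.extend h, fun k =>
    ⟨⟨q k, Module.Basis.subset_extend h ⟨k, rfl⟩⟩, rfl, ?_⟩⟩
  simp

/-- Every countable field of characteristic `0` acts with dense images on some subgroup
of `ℝ`. -/
theorem exists_denseScalars (K : Type) [Field K] [CharZero K] [Countable K] :
    ∃ (V : Type) (_ : AddCommGroup V) (_ : LinearOrder V) (_ : IsOrderedAddMonoid V)
      (_ : Module K V) (one : V), 0 < one ∧ DenseScalars K V := by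
  have : Countable (Requirement K) := by unfold Requirement; infer_instance
  choose E B e he hB using fun i : Requirement K => exists_basis_extending i.2.1.2
  -- One copy of `K` per requirement, each with a ℚ-basis extending the tuple of that requirement.
  -- There are countably many basis vectors, so ℝ has room for independent images.
  let b : Module.Basis (Σ i : Requirement K, E i) ℚ (Requirement K →₀ K) := Finsupp.basis B
  obtain ⟨r, hr⟩ := exists_linearIndependent_real (Σ i : Requirement K, E i)
  -- The image of a basis vector belonging to the tuple is rescaled into the rational interval
  -- prescribed for it. Members of the tuple are distinct, so only one interval is prescribed; other
  -- basis vectors keep the factor 1.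
  have hscale : ∀ j : Σ i : Requirement K, E i, ∃ s : ℚ, s ≠ 0 ∧ ∀ k, (j.2 : K) = j.1.2.1.1 k →
      ((j.1.2.2.1 k).1 : ℝ) < s * r j ∧ s * r j < ((j.1.2.2.1 k).2 : ℝ) := by
    intro j
    by_cases hj : ∃ k, (j.2 : K) = j.1.2.1.1 k
    · obtain ⟨k, hk⟩ := hj
      obtain ⟨s, hs0, hs⟩ := exists_rat_mul_mem_Ioo
        (Rat.cast_lt (K := ℝ).2 (j.1.2.2.2 k)) (hr.ne_zero j)
      refine ⟨s, hs0, fun k' hk' => ?_⟩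
      rw [← j.1.2.1.2.injective (hk.symm.trans hk')]
      exact hs
    · exact ⟨1, one_ne_zero, fun k hk => (hj ⟨k, hk⟩).elim⟩
  choose s hs0 hs using hscale
  let φ : (Requirement K →₀ K) →ₗ[ℚ] ℝ := b.constr ℚ fun j => s j • r j
  have hφ : Function.Injective φ := by
    have h1 : LinearIndependent ℚ fun j => s j • r j :=
      hr.units_smul fun j => Units.mk0 (s j) (hs0 j)
    have h2 : ∀ x, φ x = Finsupp.linearCombination ℚ (fun j => s j • r j) (b.repr x) := by
      intro x
      rw [Module.Basis.constr_apply, Finsupp.linearCombination_apply]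
    intro x y hxy
    rw [h2, h2] at hxy
    exact b.repr.injective (h1 hxy)
  let _ : LinearOrder (Requirement K →₀ K) := LinearOrder.lift' φ hφ
  have hle : ∀ x y, φ x ≤ φ y ↔ x ≤ y := fun _ _ => Iff.rfl
  have hlt : ∀ x y, φ x < φ y ↔ x < y := fun _ _ => Iff.rfl
  have hmono : IsOrderedAddMonoid (Requirement K →₀ K) :=
    { add_le_add_left := fun x y h z => by
        rw [← hle, map_add, map_add]
        exact add_le_add_left ((hle _ _).2 h) _ }
  have hone : ∃ x : Requirement K →₀ K, 0 < x := by
    -- The empty requirement serves only to produce a nonzero vector; this vector or its negative is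
    -- positive.
    let i : Requirement K :=
      ⟨0, ⟨Fin.elim0, linearIndependent_empty_type⟩, ⟨Fin.elim0, fun k => k.elim0⟩⟩
    have h0 : Finsupp.single i (1 : K) ≠ 0 := by simp
    rcases h0.lt_or_gt with h | h
    · exact ⟨_, neg_pos.2 h⟩
    · exact ⟨_, h⟩
  obtain ⟨one, hone⟩ := hone
  refine ⟨Requirement K →₀ K, inferInstance, inferInstance, hmono, inferInstance, one, hone, ⟨?_⟩⟩
  intro m q hq x y hxy
  have hbox : ∀ k, ∃ t : ℚ × ℚ, t.1 < t.2 ∧ φ (x k) < t.1 ∧ (t.2 : ℝ) < φ (y k) := by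
    intro k
    obtain ⟨c, h1, h2⟩ := exists_rat_btwn ((hlt _ _).2 (hxy k))
    obtain ⟨d, h3, h4⟩ := exists_rat_btwn h2
    exact ⟨(c, d), Rat.cast_lt.1 h3, h1, h4⟩
  choose t ht1 ht2 ht3 using hbox
  -- The generator of the copy of `K` attached to this requirement is the witness: its multiples by
  -- the `q k` are basis vectors whose images were placed in the box `t`.
  let i : Requirement K := ⟨m, ⟨q, hq⟩, ⟨t, ht1⟩⟩
  refine ⟨Finsupp.single i 1, fun k => ?_⟩
  have h1 : q k • Finsupp.single i (1 : K) = b ⟨i, e i k⟩ := by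
    have : b ⟨i, e i k⟩ = Finsupp.single i (B i (e i k)) := by rw [Finsupp.coe_basis]
    rw [this, hB i k, Finsupp.smul_single, smul_eq_mul, mul_one]
  have h2 : φ (b ⟨i, e i k⟩) = s ⟨i, e i k⟩ * r ⟨i, e i k⟩ := by
    rw [Module.Basis.constr_basis, Rat.smul_def]
  have h3 := hs ⟨i, e i k⟩ k (he i k)
  rw [← hlt, ← hlt, h1, h2]
  exact ⟨(ht2 k).trans h3.1, h3.2.trans (ht3 k)⟩

/-- The `(<, +, 0, 1, (λ_q)_q)`-structure on an ordered `ℚ(t)`-vector space. -/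
@[reducible]
noncomputable def vectorSpaceStructure {V : Type w} [AddCommGroup V] [LE V]
    [Module (RatFunc ℚ) V] (one : V) :
    LQt.Structure V where
  funMap := fun
    | .inl (.inl .zero), _ => 0
    | .inl (.inl .one), _ => one
    | .inl (.inl .add), x => x 0 + x 1
    | .inr (.lam q), x => q • x 0
  RelMap := fun
    | .inl (.inr .le), x => x 0 ≤ x 1

theorem models_Tt_of_denseScalars {V : Type w} [AddCommGroup V] [LinearOrder V]
    [IsOrderedAddMonoid V] [Module (RatFunc ℚ) V] {one : V} (hone : 0 < one)
    [DenseScalars (RatFunc ℚ) V] : letI := vectorSpaceStructure one; V ⊨ Tt := by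
  let _ := vectorSpaceStructure one
  let _ := reduct V
  have : LOag.OrderedStructure V := ⟨fun _ => Iff.rfl⟩
  have : LQt.OrderedStructure V := ⟨fun _ => Iff.rfl⟩
  have hadd : ∀ {α : Type} (v : α → V) (s t : LOag.Term α),
      (addT s t).realize v = s.realize v + t.realize v := fun v s t =>
    Term.realize_functions_apply₂
  have hzero : ∀ {α : Type} (v : α → V), (zeroT : LOag.Term α).realize v = 0 := fun v => rfl
  have hone' : ∀ {α : Type} (v : α → V), (oneT : LOag.Term α).realize v = one := fun v => rfl
  have hnsmul : ∀ {α : Type} (v : α → V) (n : ℕ) (t : LOag.Term α),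
      (nsmulT n t).realize v = n • t.realize v := by
    intro α v n t
    induction n with
    | zero => rw [zero_smul]; exact hzero v
    | succ n ih => rw [nsmulT, hadd, ih, succ_nsmul]
  have hlam : ∀ {α : Type} (v : α → V) (q : RatFunc ℚ) (t : LQt.Term α),
      (lamT q t).realize v = q • t.realize v := fun v q t =>
    Term.realize_functions_apply₁
  have haddT : ∀ {α : Type} (v : α → V) (s t : LQt.Term α),
      (addTt s t).realize v = s.realize v + t.realize v := fun v s t =>
    Term.realize_functions_apply₂
  refine Theory.model_union_iff.2
    ⟨Theory.model_union_iff.2 ⟨(LHom.onTheory_model incl _).2 ?_, ?_⟩, ?_⟩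
  · refine Theory.model_union_iff.2 ⟨Theory.model_union_iff.2 ⟨inferInstance, ?_⟩, ?_⟩
    · rw [Theory.model_iff]
      rintro φ (rfl | rfl | rfl | rfl | rfl | rfl) <;>
      simp only [Sentence.Realize, Formula.Realize, BoundedFormula.realize_all,
        BoundedFormula.realize_ex, BoundedFormula.realize_bdEqual, BoundedFormula.realize_imp,
        Term.realize_lt, hadd, hzero, hone']
      · exact fun a b c => add_assoc _ _ _
      · exact fun a b => add_comm _ _
      · exact fun a => add_zero _
      · exact fun a => ⟨-a, add_neg_cancel a⟩
      · exact fun a b c h => add_lt_add_left h _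
      · exact hone
    · rw [Theory.model_iff]
      rintro φ ⟨n, hn, rfl⟩
      simp only [divisibleBy, Sentence.Realize, Formula.Realize, BoundedFormula.realize_all,
        BoundedFormula.realize_ex, BoundedFormula.realize_bdEqual, hnsmul]
      intro x
      refine ⟨(n : RatFunc ℚ)⁻¹ • x, ?_⟩
      change n • ((n : RatFunc ℚ)⁻¹ • x) = x
      rw [← Nat.cast_smul_eq_nsmul (RatFunc ℚ), smul_inv_smul₀ (Nat.cast_ne_zero.2 (by omega))]
  · rw [Theory.model_iff]
    rintro φ (((⟨q, rfl⟩ | ⟨q, r, rfl⟩) | ⟨q, r, rfl⟩) | rfl) <;>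
    simp only [Sentence.Realize, Formula.Realize, BoundedFormula.realize_all,
      BoundedFormula.realize_bdEqual, hlam, haddT]
    · exact fun a b => smul_add _ _ _
    · exact fun a => add_smul _ _ _
    · exact fun a => mul_smul _ _ _
    · exact fun a => one_smul _ _
  · rw [Theory.model_iff]
    rintro φ ⟨m, q, hq, rfl⟩
    refine BoundedFormula.realize_alls.2 fun xs => ?_
    simp only [Function.comp_apply, BoundedFormula.realize_imp, BoundedFormula.realize_iInf,
      BoundedFormula.realize_ex, BoundedFormula.realize_inf, Term.realize_lt, hlam,
      Term.realize_var, Sum.elim_inr, Fin.snoc_castSucc, Fin.snoc_last]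
    exact fun h => DenseScalars.dense q hq _ _ h

theorem isSatisfiable_Tt : Tt.IsSatisfiable := by
  have := countable_ratFunc
  obtain ⟨V, _, _, _, _, one, hone, _⟩ := exists_denseScalars (RatFunc ℚ)
  let _ := vectorSpaceStructure one
  have := models_Tt_of_denseScalars hone
  exact Theory.Model.isSatisfiable V

theorem isSatisfiable_ODAG : ODAG.IsSatisfiable := by
  have h : (incl.onTheory ODAG).IsSatisfiable := isSatisfiable_Tt.mono
    (Set.subset_union_left.trans Set.subset_union_left)
  exact Theory.isSatisfiable_of_isSatisfiable_onTheory incl h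

end Existence

end OpenCore

universe w

open FirstOrder OpenCore

/-! ### The main theorem -/

theorem mainTheorem1 :
    -- the theory of ordered divisible abelian groups is an open core of `T_t`
    IsOpenCore.{0, 0, 0, 0, w} ODAG Tt ∧
    (∀ (M : Type w) [LQt.Structure M] [Nonempty M], M ⊨ Tt →
      -- open sets definable in `M` are definable in the reduct
      (∀ (n : ℕ) (U : Set (Fin n → M)), IsOpenIn LQt U → DefinableIn LQt U →
        @DefinableIn LOag M (reduct M) n U) ∧
      -- `M` defines a function with dense graph
      (∃ f : M → M, DefinableIn LQt {x : Fin 2 → M | x 1 = f (x 0)} ∧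
        IsDenseIn LQt {x : Fin 2 → M | x 1 = f (x 0)})) ∧
    -- the remaining requirements for a negative answer to the question
    ODAG.IsComplete ∧ IsOMinimalTheory.{0, 0, w} ODAG ∧
    Tt.IsSatisfiable ∧ TheoryHasEP.{0, 0, w} Tt := by
  refine ⟨⟨extendsDLO_Tt, fun M _ _ hM => ⟨reduct M, ?_, interdefinable_coreLang_reduct hM⟩⟩,
    fun M _ _ hM => ⟨fun n U h1 h2 => definableIn_reduct_of_isOpenIn hM h1 h2,
      exists_definable_function_dense_graph hM⟩,
    isComplete_ODAG isSatisfiable_ODAG, ⟨extendsDLO_ODAG, fun M _ _ hM => ?_⟩,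
    isSatisfiable_Tt, fun M _ _ hM => hasEP_of_models_Tt hM⟩
  · let _ := reduct M
    exact (FirstOrder.Language.LHom.onTheory_model incl ODAG).1
      (hM.mono (Set.subset_union_left.trans Set.subset_union_left))
  · obtain ⟨_, _, _, _, _, one, -, _, _⟩ := exists_linearStructure_of_models_ODAG M hM
    exact isOMinimal_of_linearStructure one
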